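/- **Setting.** Let $\Sigma$ (structural symbols) and $AP$ (further atomic propositions) be finite disjoint sets, $\#\notin\Sigma\cup AP$, and let $M$ be an operator precedence matrix, i.e. a partial function assigning to pairs of $\Sigma$ one of $\lessdot,\doteq,\gtrdot$, extended by $\#\lessdot a$, $a\gtrdot\#$ ($a\in\Sigma$) and $\#\doteq\#$. A (finite) *OP word* has positions $0,\dots,n$ with $n\ge 1$; $\#$ holds exactly in positions $0$ and $n$, exactly one symbol of $\Sigma$ holds in every other position, and each position carries a set of propositions of $AP$. For positions, $i\sim j$ means that $\sim$ holds between their symbols. A *chain* is a string $c_0s_0c_1s_1\cdots c_\ell s_\ell c_{\ell+1}$, $\ell\ge1$, with $c_0\lessdot c_1\doteq\dots\doteq c_\ell\gtrdot c_{\ell+1}$ and each $s_i$ either empty or such that $c_is_ic_{i+1}$ is a chain; $\chi(i,j)$ means that positions $i<j$ are the first and last position of a chain occurring in the word. The word must be compatible with $M$: the precedence relation is defined between consecutive positions and between $i,j$ whenever $\chi(i,j)$. **Logic.** Formulas, with $t\in\{d,u\}$: $\varphi ::= a\in\Sigma\cup AP\mid\neg\varphi\mid\varphi\wedge\varphi\mid\varphi\vee\varphi\mid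 \bigcirc^t\varphi\mid\tilde\bigcirc^t\varphi\mid\chi_F^t\varphi\mid\tilde\chi_F^t\varphi\mid\varphi\,\mathcal U_\chi^t\varphi\mid\varphi\,\mathcal R_\chi^t\varphi\mid\bigcirc_H^t\varphi\mid\tilde\bigcirc_H^t\varphi\mid\varphi\,\mathcal U_H^t\varphi\mid\varphi\,\mathcal R_H^t\varphi$ (a tilde marks the weak version). Write $i\preceq^d j$ for "$i\lessdot j$ or $i\doteq j$" and $i\preceq^u j$ for "$i\gtrdot j$ or $i\doteq j$". Truth at a position $i$: propositions and Boolean connectives as usual; $\bigcirc^t\varphi$: $i<n$, $i\preceq^t i+1$ and $\varphi$ at $i+1$; $\chi_F^t\varphi$: $\varphi$ holds at some $j>i$ with $\chi(i,j)$ and $i\preceq^t j$; $\bigcirc_H^u\varphi$: for some $h<i$ with $\chi(h,i)$, $h\lessdot i$, the position $j=\min\{k>i:\chi(h,k),h\lessdot k\}$ exists and satisfies $\varphi$; $\bigcirc_H^d\varphi$: for some $h>i$ with $\chi(i,h)$, $i\gtrdot h$, the position $j=\min\{k>i:\chi(k,h),k\gtrdot h\}$ exists and satisfies $\varphi$; the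 weak versions $\tilde\bigcirc^t,\tilde\chi_F^t,\tilde\bigcirc_H^t$ are the duals ($\varphi$ holds at all such positions). The *summary path* $\pi_\chi^t(i,j)$ is the sequence $i=i_1<\dots<i_m=j$ where $i_{p+1}$ is the largest $h\le j$ with $\chi(i_p,h)$ and $i_p\preceq^t h$ if there is one, and otherwise is $i_p+1$, provided $i_p\preceq^t i_p+1$. The *hierarchical path* $\pi_H^d(i,j)$ is a sequence $i=i_1<\dots<i_m=j$ such that for some $h>j$ all $p$ satisfy $\chi(i_p,h)$, $i_p\gtrdot h$, and no $k$ strictly between consecutive elements has $\chi(k,h)$; $\pi_H^u(i,j)$ is analogous with $h<j$, $\chi(h,i_p)$, $h\lessdot i_p$, and no $k$ strictly between with $\chi(h,k)$. For $\Pi\in\{\chi,H\}$: $\alpha\,\mathcal U_\Pi^t\beta$ holds at $i$ iff for some $j\ge i$ the path $\pi_\Pi^t(i,j)$ exists, $\beta$ holds at $j$ and $\alpha$ at all earlier elements of the path; $\alpha\,\mathcal R_\Pi^t\beta$ holds at $i$ iff for every $j\ge i$ such that the path $\pi_\Pi^t(i,j)$ exists, either $\beta$ holds on the whole path, or $\alpha$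 holds at some $k$ of the path and $\beta$ at all its elements $\le k$. A formula is *satisfiable* if it is true at position $1$ of some OP word. **Encoding.** Let $\phi$ be a formula, replaced by its negation normal form (negation only in front of propositions). Its closure $C(\phi)$ is the least set containing $\phi$, closed under immediate subformulas, and with every $\psi=\alpha\,\mathcal U_\chi^t\beta$ containing $\bigcirc^t\psi,\chi_F^t\psi$; with $\psi=\alpha\,\mathcal R_\chi^t\beta$ containing $\tilde\bigcirc^t\psi,\tilde\chi_F^t\psi$; with $\psi=\alpha\,\mathcal U_H^t\beta$ containing $\bigcirc_H^t\psi$; with $\psi=\alpha\,\mathcal R_H^t\beta$ containing $\tilde\bigcirc_H^t\psi$. For $k>0$ the encoding is a formula over two finite enumerated sorts: nodes $\{0,\dots,k\}$ and symbols $\mathcal S=\Sigma\cup AP\cup\{\#,\zeta_d,\zeta_u\}\cup\{\psi_G:\psi\in C(\phi)\text{ a strong or weak next, chain next or hierarchical next formula}\}$. Uninterpreted: predicates $\Gamma(s,x)$, $\bar\Sigma(s)$ and $\lessdot,\doteq,\gtrdot$ on $\mathcal S$; functions $\mathrm{smb},\mathrm{struct}$ from nodes to symbols and $\mathrm{stack},\mathrm{ctx}$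 from nodes to nodes. Put $\mathrm{push}(x)\equiv\mathrm{smb}(x)\lessdot\mathrm{struct}(x)$, $\mathrm{shift}(x)\equiv\mathrm{smb}(x)\doteq\mathrm{struct}(x)$, $\mathrm{pop}(x)\equiv\mathrm{smb}(x)\gtrdot\mathrm{struct}(x)$. For a formula $\psi$, $[\psi](x)$ is: $\Gamma(\psi,x)$ for propositions, $\Gamma(\psi_G,x)$ for next-type formulas, homomorphic on Boolean connectives, and $[\alpha\,\mathcal U_\chi^t\beta]=[\beta]\vee([\alpha]\wedge([\bigcirc^t(\alpha\,\mathcal U_\chi^t\beta)]\vee[\chi_F^t(\alpha\,\mathcal U_\chi^t\beta)]))$, $[\alpha\,\mathcal R_\chi^t\beta]=[\beta]\wedge([\alpha]\vee([\tilde\bigcirc^t(\alpha\,\mathcal R_\chi^t\beta)]\wedge[\tilde\chi_F^t(\alpha\,\mathcal R_\chi^t\beta)]))$, $[\alpha\,\mathcal U_H^t\beta]=([\beta]\wedge\Gamma(\zeta_t,x))\vee([\alpha]\wedge[\bigcirc_H^t(\alpha\,\mathcal U_H^t\beta)])$, $[\alpha\,\mathcal R_H^t\beta]=(\Gamma(\zeta_t,x)\to[\beta])\wedge([\alpha]\vee[\tilde\bigcirc_H^t(\alpha\,\mathcal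 R_H^t\beta)])$. Write $x\preceq^t y$ for $\mathrm{struct}(x)\preceq^t\mathrm{struct}(y)$. The *$k$-unraveling* $|\phi|_k$ is the conjunction of: * *axioms*: $\bar\Sigma$ holds exactly of $\Sigma\cup\{\#\}$; for all $x$, $\bar\Sigma(\mathrm{struct}(x))$, $\bar\Sigma(\mathrm{smb}(x))$, $\Gamma(\mathrm{struct}(x),x)$; the predicates $\lessdot,\doteq,\gtrdot$ hold exactly as in $M$; * *init*: $\mathrm{stack}(0)=\mathrm{ctx}(0)=\mathrm{stack}(1)=\mathrm{ctx}(1)=0$, $\mathrm{struct}(0)=\mathrm{smb}(0)=\mathrm{smb}(1)=\#$, and $[\phi](1)$; * *steps*, for all $1\le x<k$: $x$ is push, shift or pop. If $\mathrm{push}(x)$ or $\mathrm{shift}(x)$: $\Gamma((\bigcirc^t\alpha)_G,x)\to[\alpha](x+1)$ for all $\bigcirc^t\alpha\in C(\phi)$, and $\mathrm{smb}(x+1)=\mathrm{struct}(x)$. If $\mathrm{push}(x)$, moreover $\mathrm{stack}(x+1)=x$, and $\mathrm{ctx}(x+1)$ equals $0$ if $\mathrm{stack}(x)=0$, else $x-1$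 if $x-1$ is push or shift, else $\mathrm{ctx}(x-1)$ if $\mathrm{pop}(x-1)$. If $\mathrm{shift}(x)$, moreover $\mathrm{stack}(x+1)=\mathrm{stack}(x)$ and $\mathrm{ctx}(x+1)=\mathrm{ctx}(x)$. If $\mathrm{pop}(x)$: $\Gamma(s,x)\leftrightarrow\Gamma(s,x+1)$ for all $s$, and $\mathrm{smb},\mathrm{stack},\mathrm{ctx}$ of $x+1$ are those of $\mathrm{stack}(x)$; * *non-rejection*, for all $1\le x\le k$ (formulas named range over $C(\phi)$): 2. at most one $s$ with $\bar\Sigma(s)$ has $\Gamma(s,x)$; 3. if $\Gamma(\#,x)$, then $\Gamma(s,x)$ fails for $s\in AP$, for $s=\zeta_d,\zeta_u$, and for $s=\psi_G$ with $\psi$ a strong next, chain next or hierarchical next formula; 4. if $x-1$ is push or shift: not both $\Gamma((\bigcirc^d\alpha)_G,x-1)$ and $\mathrm{struct}(x-1)\gtrdot\mathrm{struct}(x)$; the same for $u$ with $\lessdot$; 5. if $x-1$ is push or shift: $\Gamma((\tilde\bigcirc^d\alpha)_G,x-1)$ and not $\mathrm{struct}(x-1)\gtrdot\mathrm{struct}(x)$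 imply $[\alpha](x)$; the same for $u$ with $\lessdot$; 6. if $\mathrm{pop}(x)$, $y<x$, and $y=\mathrm{stack}(x)$ or ($\mathrm{shift}(y)$ and $\mathrm{stack}(y)=\mathrm{stack}(x)$): $\Gamma((\chi_F^t\alpha)_G,y)$ implies that some $z$ with $y\le z\le x$ has $\mathrm{pop}(z)$, $\mathrm{ctx}(z)=y$, $y\preceq^t z$, $[\alpha](z)$; 7. if $\mathrm{pop}(x)$: $\Gamma((\tilde\chi_F^t\alpha)_G,\mathrm{ctx}(x))$ and $\mathrm{ctx}(x)\preceq^t x$ imply $[\alpha](x)$; 8. $\mathrm{hu}_F(x-1)$ for $F=\{(\bigcirc_H^u\alpha)_G\}$; if $\mathrm{pop}(x-1)$, then $\Gamma((\bigcirc_H^u\alpha)_G,\mathrm{stack}(x-1))$ implies $[\alpha](x-1)$ and $\mathrm{push}(x)$; 9. if $\mathrm{pop}(x-1)$, $\mathrm{push}(x)$, $\mathrm{pop}(\mathrm{stack}(x-1)-1)$, $\mathrm{push}(\mathrm{stack}(x-1))$: $\Gamma((\tilde\bigcirc_H^u\alpha)_G,\mathrm{stack}(x-1))$ implies $[\alpha](x-1)$;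 10. $\mathrm{hd}_F(x-1)$ for $F=\{(\bigcirc_H^d\alpha)_G\}$; if $\mathrm{pop}(x-1)$ and $\mathrm{pop}(x)$, then $\Gamma((\bigcirc_H^d\alpha)_G,\mathrm{ctx}(x-1))$ implies $[\alpha](\mathrm{ctx}(x-2))$ and $\mathrm{pop}(x-2)$; 11. if $\mathrm{pop}(x-2),\mathrm{pop}(x-1),\mathrm{pop}(x)$: $\Gamma((\tilde\bigcirc_H^d\alpha)_G,\mathrm{ctx}(x-1))$ implies $[\alpha](\mathrm{ctx}(x-2))$; 12. $\mathrm{hd}_{\{\zeta_d\}}(x-1)$; $\mathrm{pop}(x-1)\wedge\mathrm{pop}(x)\to\Gamma(\zeta_d,\mathrm{ctx}(x-1))$; $\mathrm{hu}_{\{\zeta_u\}}(x)$; $\mathrm{pop}(x-1)\wedge\mathrm{push}(x)\to\Gamma(\zeta_u,x)$; 13. if $x$ is push or shift, there is no $y$ with $1\le y<x$ that is pending (a push node for which no pop node $z<x$ has $\mathrm{stack}(z)=y$, or a shift node for which no pop node $z<x$ has $\mathrm{stack}(z)=\mathrm{stack}(y)$) such that $\mathrm{smb}(x)=\mathrm{smb}(y)$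 and the labels $\{s:\Gamma(s,\cdot)\}$ of $x$ and $y$, of $\mathrm{stack}(x)$ and $\mathrm{stack}(y)$, and of $\mathrm{ctx}(x)$ and $\mathrm{ctx}(y)$ coincide. Here, with $\mathrm{any}_F(x)\equiv\bigvee_{s\in F}\Gamma(s,x)$, $\mathrm{hu}_F(x)$ says that $\mathrm{any}_F(x)$ implies $\mathrm{pop}(x)\vee(\mathrm{push}(x)\wedge\mathrm{pop}(x-1))$, and $\mathrm{hd}_F(x)$ says that $\neg\mathrm{pop}(x)\wedge\mathrm{any}_F(x)$ implies $\mathrm{push}(x+1)$, and $\mathrm{pop}(x)\wedge\mathrm{any}_F(\mathrm{ctx}(x))$ implies $\neg\mathrm{shift}(x+1)$. (Index subtraction is truncated at $0$.) Finally $e(x)\equiv\Gamma(\#,x)\wedge\mathrm{stack}(x)=0$. **Theorem.** If $|\phi|_k\wedge e(k)$ is satisfiable for some $k>0$, then $\phi$ is satisfiable. -/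

import Mathlib

namespace POTL

universe u v

/-! ## Operator precedence alphabets, words and chains -/

/-- The three precedence relations: `lt` (yields precedence), `eq` (equal in precedence),
`gt` (takes precedence). -/
inductive PR : Type
  | lt
  | eq
  | gt

/-- An operator precedence matrix over the structural symbols `Sg`: a partial function. -/
structure OPM (Sg : Type u) where
  rel : Sg → Sg → Option PR

/-- The matrix on `Sg ∪ {#}`, where `none` stands for the delimiter `#`. The initial `#` yields
precedence to every symbol, every symbol takes precedence over the final `#`, and `#` is equal in
precedence to itself. -/
def OPM.prec {Sg : Type u} (M : OPM Sg) : Option Sg → Option Sg → Option PR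
  | some a, some b => M.rel a b
  | none, some _ => some PR.lt
  | some _, none => some PR.gt
  | none, none => some PR.eq

inductive ChainKind : Type
  | link
  | body
  | chain

/-- Chains of a sequence of symbols, as pairs of positions.
A composed chain is `c₀ s₀ c₁ s₁ … c_ℓ s_ℓ c_{ℓ+1}` with `ℓ ≥ 1`,
`c₀ ⋖ c₁ ≐ … ≐ c_ℓ ⋗ c_{ℓ+1}`, in which every `s_i` is empty or is the body of a chain with
contexts `c_i` and `c_{i+1}` (it is simple if all `s_i` are empty).
* `link i j`: `j = i + 1`, or `i` and `j` are the contexts of a chain;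
* `body i p`: `i` is the position of `c₀` and `p` the position of some `c_m`, `1 ≤ m ≤ ℓ`, in an
  initial part `c₀ s₀ c₁ … s_{m-1} c_m` of a chain;
* `chain i j`: `i` and `j` are the left and the right context of a chain. -/
inductive ChainPart {Sg : Type u} (M : OPM Sg) (sym : ℕ → Option Sg) :
    ChainKind → ℕ → ℕ → Prop
  | adjacent (i : ℕ) : ChainPart M sym .link i (i + 1)
  | nested {i j : ℕ} (h : ChainPart M sym .chain i j) : ChainPart M sym .link i j
  | first {i p : ℕ} (h : ChainPart M sym .link i p)
      (hr : M.prec (sym i) (sym p) = some PR.lt) : ChainPart M sym .body i p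
  | next {i p q : ℕ} (hb : ChainPart M sym .body i p) (hl : ChainPart M sym .link p q)
      (hr : M.prec (sym p) (sym q) = some PR.eq) : ChainPart M sym .body i q
  | close {i p j : ℕ} (hb : ChainPart M sym .body i p) (hl : ChainPart M sym .link p j)
      (hr : M.prec (sym p) (sym j) = some PR.gt) : ChainPart M sym .chain i j

/-- A finite OP word with positions `0, …, last` over structural symbols `Sg` and further atomic
propositions `AP`. Exactly one structural symbol (or `#`) holds in each position, and `#` holds
exactly in the positions `0` and `last`. The word is compatible with `M`. -/
structure OPWord {Sg : Type u} (M : OPM Sg) (AP : Type v) where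
  last : ℕ
  last_pos : 0 < last
  sym : ℕ → Option Sg
  lab : ℕ → Set AP
  sym_zero : sym 0 = none
  sym_last : sym last = none
  sym_inner : ∀ i, 0 < i → i < last → sym i ≠ none
  compat_adjacent : ∀ i, i < last → M.prec (sym i) (sym (i + 1)) ≠ none
  compat_chain : ∀ i j, j ≤ last → ChainPart M sym .chain i j → M.prec (sym i) (sym j) ≠ none

/-! ## Syntax and semantics of the future fragment on finite words -/

/-- `d`: downward, `u`: upward. -/
inductive Dir : Type
  | d
  | u

inductive Formula (Sg : Type u) (AP : Type v) : Type (max u v)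
  | str (a : Sg)
  | prop (p : AP)
  | neg (φ : Formula Sg AP)
  | and (φ ψ : Formula Sg AP)
  | or (φ ψ : Formula Sg AP)
  /-- strong next -/
  | next (t : Dir) (φ : Formula Sg AP)
  /-- weak next -/
  | wnext (t : Dir) (φ : Formula Sg AP)
  /-- strong chain next -/
  | cnext (t : Dir) (φ : Formula Sg AP)
  /-- weak chain next -/
  | wcnext (t : Dir) (φ : Formula Sg AP)
  /-- summary until -/
  | cuntil (t : Dir) (φ ψ : Formula Sg AP)
  /-- summary release -/
  | crelease (t : Dir) (φ ψ : Formula Sg AP)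
  /-- strong hierarchical next -/
  | hnext (t : Dir) (φ : Formula Sg AP)
  /-- weak hierarchical next -/
  | whnext (t : Dir) (φ : Formula Sg AP)
  /-- hierarchical until -/
  | huntil (t : Dir) (φ ψ : Formula Sg AP)
  /-- hierarchical release -/
  | hrelease (t : Dir) (φ ψ : Formula Sg AP)

def Dir.pr : Dir → PR
  | .d => PR.lt
  | .u => PR.gt

namespace OPWord

variable {Sg : Type u} {M : OPM Sg} {AP : Type v} (w : OPWord M AP)

/-- The precedence relation `r` holds between the positions `i` and `j`. -/
def Rel (r : PR) (i j : ℕ) : Prop :=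
  M.prec (w.sym i) (w.sym j) = some r

/-- `i ⋖ j` or `i ≐ j` for the downward, `i ⋗ j` or `i ≐ j` for the upward direction. -/
def DirRel (t : Dir) (i j : ℕ) : Prop :=
  w.Rel t.pr i j ∨ w.Rel PR.eq i j

/-- The chain relation on positions. -/
def Chain (i j : ℕ) : Prop :=
  j ≤ w.last ∧ ChainPart M w.sym .chain i j

/-- `b` is the successor of `a` on the summary paths that end in `j`. -/
def SummaryStep (t : Dir) (j a b : ℕ) : Prop :=
  IsGreatest {h | h ≤ j ∧ w.Chain a h ∧ w.DirRel t a h} b ∨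
    ((¬ ∃ h, h ≤ j ∧ w.Chain a h ∧ w.DirRel t a h) ∧ b = a + 1 ∧ w.DirRel t a (a + 1))

/-- `l` lists the positions of the downward or upward summary path between `i` and `j`. -/
def IsSummaryPath (t : Dir) (i j : ℕ) (l : List ℕ) : Prop :=
  j ≤ w.last ∧ l.head? = some i ∧ l.getLast? = some j ∧ l.IsChain (w.SummaryStep t j)

/-- `l` lists the positions of the downward or upward hierarchical path between `i` and `j`. -/
def IsHierPath (t : Dir) (i j : ℕ) (l : List ℕ) : Prop :=
  l.head? = some i ∧ l.getLast? = some j ∧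
    match t with
    | .d => ∃ h, j < h ∧ (∀ p ∈ l, w.Chain p h ∧ w.Rel PR.gt p h) ∧
        l.IsChain (fun a b => a < b ∧ ¬ ∃ k, a < k ∧ k < b ∧ w.Chain k h)
    | .u => ∃ h, h < j ∧ (∀ p ∈ l, w.Chain h p ∧ w.Rel PR.lt h p) ∧
        l.IsChain (fun a b => a < b ∧ ¬ ∃ k, a < k ∧ k < b ∧ w.Chain h k)

/-- `j` is the hierarchical successor of `i`. -/
def HierNext (t : Dir) (i j : ℕ) : Prop :=
  match t with
  | .u => ∃ h, h < i ∧ w.Chain h i ∧ w.Rel PR.lt h i ∧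
      IsLeast {k | i < k ∧ w.Chain h k ∧ w.Rel PR.lt h k} j
  | .d => ∃ h, i < h ∧ w.Chain i h ∧ w.Rel PR.gt i h ∧
      IsLeast {k | i < k ∧ w.Chain k h ∧ w.Rel PR.gt k h} j

/-- Truth of a formula in a position of the word. -/
def Sat : ℕ → Formula Sg AP → Prop
  | i, .str a => w.sym i = some a
  | i, .prop p => p ∈ w.lab i
  | i, .neg φ => ¬ Sat i φ
  | i, .and φ ψ => Sat i φ ∧ Sat i ψ
  | i, .or φ ψ => Sat i φ ∨ Sat i ψ
  | i, .next t φ => i < w.last ∧ w.DirRel t i (i + 1) ∧ Sat (i + 1) φ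
  | i, .wnext t φ => i < w.last → w.DirRel t i (i + 1) → Sat (i + 1) φ
  | i, .cnext t φ => ∃ j, i < j ∧ w.Chain i j ∧ w.DirRel t i j ∧ Sat j φ
  | i, .wcnext t φ => ∀ j, i < j → w.Chain i j → w.DirRel t i j → Sat j φ
  | i, .cuntil t φ ψ => ∃ j l, i ≤ j ∧ w.IsSummaryPath t i j l ∧
      Sat j ψ ∧ ∀ m ∈ l, m < j → Sat m φ
  | i, .crelease t φ ψ => ∀ j l, i ≤ j → w.IsSummaryPath t i j l →
      (∀ m ∈ l, Sat m ψ) ∨ ∃ k ∈ l, Sat k φ ∧ ∀ m ∈ l, m ≤ k → Sat m ψ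
  | i, .hnext t φ => ∃ j, w.HierNext t i j ∧ Sat j φ
  | i, .whnext t φ => ∀ j, w.HierNext t i j → Sat j φ
  | i, .huntil t φ ψ => ∃ j l, i ≤ j ∧ w.IsHierPath t i j l ∧
      Sat j ψ ∧ ∀ m ∈ l, m < j → Sat m φ
  | i, .hrelease t φ ψ => ∀ j l, i ≤ j → w.IsHierPath t i j l →
      (∀ m ∈ l, Sat m ψ) ∨ ∃ k ∈ l, Sat k φ ∧ ∀ m ∈ l, m ≤ k → Sat m ψ

end OPWord

/-- A formula is satisfiable if it holds in the first letter, i.e. in position `1`, of some finite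
OP word. -/
def Satisfiable {Sg : Type u} {AP : Type v} (M : OPM Sg) (φ : Formula Sg AP) : Prop :=
  ∃ w : OPWord M AP, w.Sat 1 φ

/-! ## Negation normal form and closure -/

/-- `nnfAux true φ` is the negation normal form of `φ`, and `nnfAux false φ` that of `¬ φ`. -/
def nnfAux {Sg : Type u} {AP : Type v} : Bool → Formula Sg AP → Formula Sg AP
  | true, .str a => .str a
  | false, .str a => .neg (.str a)
  | true, .prop p => .prop p
  | false, .prop p => .neg (.prop p)
  | true, .neg φ => nnfAux false φ
  | false, .neg φ => nnfAux true φ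
  | true, .and φ ψ => .and (nnfAux true φ) (nnfAux true ψ)
  | false, .and φ ψ => .or (nnfAux false φ) (nnfAux false ψ)
  | true, .or φ ψ => .or (nnfAux true φ) (nnfAux true ψ)
  | false, .or φ ψ => .and (nnfAux false φ) (nnfAux false ψ)
  | true, .next t φ => .next t (nnfAux true φ)
  | false, .next t φ => .wnext t (nnfAux false φ)
  | true, .wnext t φ => .wnext t (nnfAux true φ)
  | false, .wnext t φ => .next t (nnfAux false φ)
  | true, .cnext t φ => .cnext t (nnfAux true φ)
  | false, .cnext t φ => .wcnext t (nnfAux false φ)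
  | true, .wcnext t φ => .wcnext t (nnfAux true φ)
  | false, .wcnext t φ => .cnext t (nnfAux false φ)
  | true, .cuntil t φ ψ => .cuntil t (nnfAux true φ) (nnfAux true ψ)
  | false, .cuntil t φ ψ => .crelease t (nnfAux false φ) (nnfAux false ψ)
  | true, .crelease t φ ψ => .crelease t (nnfAux true φ) (nnfAux true ψ)
  | false, .crelease t φ ψ => .cuntil t (nnfAux false φ) (nnfAux false ψ)
  | true, .hnext t φ => .hnext t (nnfAux true φ)
  | false, .hnext t φ => .whnext t (nnfAux false φ)
  | true, .whnext t φ => .whnext t (nnfAux true φ)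
  | false, .whnext t φ => .hnext t (nnfAux false φ)
  | true, .huntil t φ ψ => .huntil t (nnfAux true φ) (nnfAux true ψ)
  | false, .huntil t φ ψ => .hrelease t (nnfAux false φ) (nnfAux false ψ)
  | true, .hrelease t φ ψ => .hrelease t (nnfAux true φ) (nnfAux true ψ)
  | false, .hrelease t φ ψ => .huntil t (nnfAux false φ) (nnfAux false ψ)

def nnf {Sg : Type u} {AP : Type v} (φ : Formula Sg AP) : Formula Sg AP :=
  nnfAux true φ

/-- The closure of `φ`: it contains `φ`, the immediate subformulas of its members, and the next
formulas by which its until and release formulas are unfolded. -/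
inductive Closure {Sg : Type u} {AP : Type v} (φ : Formula Sg AP) : Formula Sg AP → Prop
  | self : Closure φ φ
  | neg {α} : Closure φ (.neg α) → Closure φ α
  | and_left {α β} : Closure φ (.and α β) → Closure φ α
  | and_right {α β} : Closure φ (.and α β) → Closure φ β
  | or_left {α β} : Closure φ (.or α β) → Closure φ α
  | or_right {α β} : Closure φ (.or α β) → Closure φ β
  | next {t α} : Closure φ (.next t α) → Closure φ α
  | wnext {t α} : Closure φ (.wnext t α) → Closure φ α
  | cnext {t α} : Closure φ (.cnext t α) → Closure φ α
  | wcnext {t α} : Closure φ (.wcnext t α) → Closure φ α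
  | hnext {t α} : Closure φ (.hnext t α) → Closure φ α
  | whnext {t α} : Closure φ (.whnext t α) → Closure φ α
  | cuntil_left {t α β} : Closure φ (.cuntil t α β) → Closure φ α
  | cuntil_right {t α β} : Closure φ (.cuntil t α β) → Closure φ β
  | cuntil_next {t α β} : Closure φ (.cuntil t α β) → Closure φ (.next t (.cuntil t α β))
  | cuntil_cnext {t α β} : Closure φ (.cuntil t α β) → Closure φ (.cnext t (.cuntil t α β))
  | crelease_left {t α β} : Closure φ (.crelease t α β) → Closure φ α
  | crelease_right {t α β} : Closure φ (.crelease t α β) → Closure φ β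
  | crelease_wnext {t α β} :
      Closure φ (.crelease t α β) → Closure φ (.wnext t (.crelease t α β))
  | crelease_wcnext {t α β} :
      Closure φ (.crelease t α β) → Closure φ (.wcnext t (.crelease t α β))
  | huntil_left {t α β} : Closure φ (.huntil t α β) → Closure φ α
  | huntil_right {t α β} : Closure φ (.huntil t α β) → Closure φ β
  | huntil_hnext {t α β} : Closure φ (.huntil t α β) → Closure φ (.hnext t (.huntil t α β))
  | hrelease_left {t α β} : Closure φ (.hrelease t α β) → Closure φ α
  | hrelease_right {t α β} : Closure φ (.hrelease t α β) → Closure φ β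
  | hrelease_whnext {t α β} :
      Closure φ (.hrelease t α β) → Closure φ (.whnext t (.hrelease t α β))

/-- The strong next formulas: next, chain next and hierarchical next. -/
def Formula.IsStrongNext {Sg : Type u} {AP : Type v} : Formula Sg AP → Prop
  | .next _ _ => True
  | .cnext _ _ => True
  | .hnext _ _ => True
  | _ => False

/-- The weak next formulas: weak next, weak chain next and weak hierarchical next. -/
def Formula.IsWeakNext {Sg : Type u} {AP : Type v} : Formula Sg AP → Prop
  | .wnext _ _ => True
  | .wcnext _ _ => True
  | .whnext _ _ => True
  | _ => False

/-! ## The encoding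

The encoding is a closed formula over two finite enumerated sorts, so that the carriers are fixed
and a model is an interpretation of the function and predicate symbols. A formula is given by the
condition that it imposes on an interpretation. -/

/-- Constants of the symbol sort: `#`, structural symbols, atomic propositions, one grounded
propositional symbol per formula `ψ`, and the two auxiliary symbols `ζ_d`, `ζ_u`. -/
inductive Sym (Sg : Type u) (AP : Type v) : Type (max u v)
  | hash
  | str (a : Sg)
  | prop (p : AP)
  | ground (ψ : Formula Sg AP)
  | zeta (t : Dir)

/-- The symbol sort for `φ`: among the grounded symbols it has those of the strong and weak next
formulas in the closure of `φ`. -/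
def symSort {Sg : Type u} {AP : Type v} (φ : Formula Sg AP) : Set (Sym Sg AP) :=
  {s | match s with
    | .ground ψ => Closure φ ψ ∧ (ψ.IsStrongNext ∨ ψ.IsWeakNext)
    | _ => True}

/-- `#` and the structural symbols, as elements of `Sg ∪ {#}`. -/
def Sym.structural {Sg : Type u} {AP : Type v} : Sym Sg AP → Option (Option Sg)
  | .hash => some none
  | .str a => some (some a)
  | _ => none

/-- The precedence relation between two symbols, if both are structural (or `#`) and it is
defined. -/
def OPM.symPrec {Sg : Type u} {AP : Type v} (M : OPM Sg) (s s' : Sym Sg AP) : Option PR :=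
  match s.structural, s'.structural with
  | some a, some b => M.prec a b
  | _, _ => none

/-- An interpretation of the symbols of the encoding. The node sort is `{0, …, k}` and the symbol
sort is `symSort φ`; the last four fields say that the function symbols take values in these sorts.
Values outside the two sorts are never consulted. -/
structure Interp {Sg : Type u} {AP : Type v} (φ : Formula Sg AP) (k : ℕ) where
  /-- `Γ(s, x)`: the symbol `s` belongs to the label of node `x` -/
  lab : Sym Sg AP → ℕ → Prop
  /-- `Σ̄(s)` -/
  isStr : Sym Sg AP → Prop
  lt : Sym Sg AP → Sym Sg AP → Prop
  eq : Sym Sg AP → Sym Sg AP → Prop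
  gt : Sym Sg AP → Sym Sg AP → Prop
  smb : ℕ → Sym Sg AP
  str : ℕ → Sym Sg AP
  stack : ℕ → ℕ
  ctx : ℕ → ℕ
  smb_mem : ∀ x ≤ k, smb x ∈ symSort φ
  str_mem : ∀ x ≤ k, str x ∈ symSort φ
  stack_le : ∀ x ≤ k, stack x ≤ k
  ctx_le : ∀ x ≤ k, ctx x ≤ k

namespace Interp

variable {Sg : Type u} {AP : Type v} {φ : Formula Sg AP} {k : ℕ} (I : Interp φ k)

/-- The next normal form of a formula (in negation normal form), with every proposition, every
next formula and `ζ_t` replaced by the corresponding atom `Γ(·, x)`. -/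
def Xnf : Formula Sg AP → ℕ → Prop
  | .str a, x => I.lab (.str a) x
  | .prop p, x => I.lab (.prop p) x
  | .neg α, x => ¬ Xnf α x
  | .and α β, x => Xnf α x ∧ Xnf β x
  | .or α β, x => Xnf α x ∨ Xnf β x
  | .next t α, x => I.lab (.ground (.next t α)) x
  | .wnext t α, x => I.lab (.ground (.wnext t α)) x
  | .cnext t α, x => I.lab (.ground (.cnext t α)) x
  | .wcnext t α, x => I.lab (.ground (.wcnext t α)) x
  | .hnext t α, x => I.lab (.ground (.hnext t α)) x
  | .whnext t α, x => I.lab (.ground (.whnext t α)) x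
  | .cuntil t α β, x => Xnf β x ∨ (Xnf α x ∧
      (I.lab (.ground (.next t (.cuntil t α β))) x ∨
        I.lab (.ground (.cnext t (.cuntil t α β))) x))
  | .crelease t α β, x => Xnf β x ∧ (Xnf α x ∨
      (I.lab (.ground (.wnext t (.crelease t α β))) x ∧
        I.lab (.ground (.wcnext t (.crelease t α β))) x))
  | .huntil t α β, x => (Xnf β x ∧ I.lab (.zeta t) x) ∨
      (Xnf α x ∧ I.lab (.ground (.hnext t (.huntil t α β))) x)
  | .hrelease t α β, x => (I.lab (.zeta t) x → Xnf β x) ∧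
      (Xnf α x ∨ I.lab (.ground (.whnext t (.hrelease t α β))) x)

def Push (x : ℕ) : Prop := I.lt (I.smb x) (I.str x)

def Shift (x : ℕ) : Prop := I.eq (I.smb x) (I.str x)

def Pop (x : ℕ) : Prop := I.gt (I.smb x) (I.str x)

def Axioms : Prop :=
  (∀ s ∈ symSort φ, I.isStr s ↔ s.structural ≠ none) ∧
    ∀ x ≤ k, I.isStr (I.str x) ∧ I.isStr (I.smb x) ∧ I.lab (I.str x) x

def Opm (M : OPM Sg) : Prop :=
  ∀ s ∈ symSort φ, ∀ s' ∈ symSort φ,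
    (I.lt s s' ↔ M.symPrec s s' = some PR.lt) ∧
    (I.eq s s' ↔ M.symPrec s s' = some PR.eq) ∧
    (I.gt s s' ↔ M.symPrec s s' = some PR.gt)

def Init : Prop :=
  I.stack 0 = 0 ∧ I.ctx 0 = 0 ∧ I.str 0 = .hash ∧ I.smb 0 = .hash ∧
  I.smb 1 = .hash ∧ I.stack 1 = 0 ∧ I.ctx 1 = 0 ∧ I.Xnf φ 1

/-! ### Step rules -/

def StepNext (x : ℕ) : Prop :=
  ∀ t α, Closure φ (.next t α) → I.lab (.ground (.next t α)) x → I.Xnf α (x + 1)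

def StepPush (x : ℕ) : Prop :=
  I.StepNext x ∧ I.smb (x + 1) = I.str x ∧ I.stack (x + 1) = x ∧
  (I.stack x = 0 → I.ctx (x + 1) = 0) ∧
  (I.stack x ≠ 0 ∧ (I.Push (x - 1) ∨ I.Shift (x - 1)) → I.ctx (x + 1) = x - 1) ∧
  (I.stack x ≠ 0 ∧ I.Pop (x - 1) → I.ctx (x + 1) = I.ctx (x - 1))

def StepShift (x : ℕ) : Prop :=
  I.StepNext x ∧ I.smb (x + 1) = I.str x ∧ I.stack (x + 1) = I.stack x ∧
  I.ctx (x + 1) = I.ctx x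

def StepPop (x : ℕ) : Prop :=
  (∀ s ∈ symSort φ, I.lab s x ↔ I.lab s (x + 1)) ∧
  I.smb (x + 1) = I.smb (I.stack x) ∧ I.stack (x + 1) = I.stack (I.stack x) ∧
  I.ctx (x + 1) = I.ctx (I.stack x)

/-! ### Negated rejecting rules -/

/-- At most one structural symbol. -/
def R2 (x : ℕ) : Prop :=
  ∀ s ∈ symSort φ, ∀ s' ∈ symSort φ,
    I.isStr s → I.isStr s' → I.lab s x → I.lab s' x → s = s'

/-- End of the word: no atomic proposition, no strong next formula, no hierarchical position. -/
def R3 (x : ℕ) : Prop :=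
  I.lab .hash x →
    (∀ ψ, Closure φ ψ → ψ.IsStrongNext → ¬ I.lab (.ground ψ) x) ∧
    (∀ p, ¬ I.lab (.prop p) x) ∧ ∀ t, ¬ I.lab (.zeta t) x

/-- Strong next. -/
def R4 (x : ℕ) : Prop :=
  I.Push (x - 1) ∨ I.Shift (x - 1) →
    (∀ α, Closure φ (.next .d α) →
      ¬ (I.lab (.ground (.next .d α)) (x - 1) ∧ I.gt (I.str (x - 1)) (I.str x))) ∧
    (∀ α, Closure φ (.next .u α) →
      ¬ (I.lab (.ground (.next .u α)) (x - 1) ∧ I.lt (I.str (x - 1)) (I.str x)))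

/-- Weak next. -/
def R5 (x : ℕ) : Prop :=
  I.Push (x - 1) ∨ I.Shift (x - 1) →
    (∀ α, Closure φ (.wnext .d α) →
      I.lab (.ground (.wnext .d α)) (x - 1) ∧ ¬ I.gt (I.str (x - 1)) (I.str x) → I.Xnf α x) ∧
    (∀ α, Closure φ (.wnext .u α) →
      I.lab (.ground (.wnext .u α)) (x - 1) ∧ ¬ I.lt (I.str (x - 1)) (I.str x) → I.Xnf α x)

def DirPr : Dir → ℕ → ℕ → Prop
  | .d, x, y => I.lt (I.str x) (I.str y) ∨ I.eq (I.str x) (I.str y)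
  | .u, x, y => I.gt (I.str x) (I.str y) ∨ I.eq (I.str x) (I.str y)

def Satisfied (t : Dir) (α : Formula Sg AP) (x y : ℕ) : Prop :=
  ∃ z, y ≤ z ∧ z ≤ x ∧ I.Pop z ∧ I.ctx z = y ∧ I.DirPr t y z ∧ I.Xnf α z

/-- Strong chain next. -/
def R6 (x : ℕ) : Prop :=
  I.Pop x → ∀ y, y < x → (y = I.stack x ∨ (I.Shift y ∧ I.stack y = I.stack x)) →
    ∀ t α, Closure φ (.cnext t α) → I.lab (.ground (.cnext t α)) y → I.Satisfied t α x y

/-- Weak chain next. -/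
def R7 (x : ℕ) : Prop :=
  I.Pop x → ∀ t α, Closure φ (.wcnext t α) →
    I.lab (.ground (.wcnext t α)) (I.ctx x) ∧ I.DirPr t (I.ctx x) x → I.Xnf α x

/-- Some symbol of the family `F` is in the label of `x`. -/
def AnyOf (F : Set (Sym Sg AP)) (x : ℕ) : Prop :=
  ∃ s ∈ F, I.lab s x

def HuCond (F : Set (Sym Sg AP)) (x : ℕ) : Prop :=
  I.AnyOf F x → I.Pop x ∨ (I.Push x ∧ I.Pop (x - 1))

def HdCond (F : Set (Sym Sg AP)) (x : ℕ) : Prop :=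
  (¬ I.Pop x ∧ I.AnyOf F x → I.Push (x + 1)) ∧
  (I.Pop x ∧ I.AnyOf F (I.ctx x) → ¬ I.Shift (x + 1))

/-- Strong hierarchical next, upward. -/
def R8 (x : ℕ) : Prop :=
  I.HuCond {s | ∃ α, Closure φ (.hnext .u α) ∧ s = .ground (.hnext .u α)} (x - 1) ∧
  (I.Pop (x - 1) → ∀ α, Closure φ (.hnext .u α) →
    I.lab (.ground (.hnext .u α)) (I.stack (x - 1)) → I.Xnf α (x - 1) ∧ I.Push x)

/-- Weak hierarchical next, upward. -/
def R9 (x : ℕ) : Prop :=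
  I.Pop (x - 1) ∧ I.Push x ∧ I.Pop (I.stack (x - 1) - 1) ∧ I.Push (I.stack (x - 1)) →
    ∀ α, Closure φ (.whnext .u α) →
      I.lab (.ground (.whnext .u α)) (I.stack (x - 1)) → I.Xnf α (x - 1)

/-- Strong hierarchical next, downward. -/
def R10 (x : ℕ) : Prop :=
  I.HdCond {s | ∃ α, Closure φ (.hnext .d α) ∧ s = .ground (.hnext .d α)} (x - 1) ∧
  (I.Pop (x - 1) ∧ I.Pop x → ∀ α, Closure φ (.hnext .d α) →
    I.lab (.ground (.hnext .d α)) (I.ctx (x - 1)) →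
      I.Xnf α (I.ctx (x - 2)) ∧ I.Pop (x - 2))

/-- Weak hierarchical next, downward. -/
def R11 (x : ℕ) : Prop :=
  I.Pop (x - 2) ∧ I.Pop (x - 1) ∧ I.Pop x →
    ∀ α, Closure φ (.whnext .d α) →
      I.lab (.ground (.whnext .d α)) (I.ctx (x - 1)) → I.Xnf α (I.ctx (x - 2))

/-- `ζ_d` and `ζ_u` mark the nodes where a downward, upward hierarchical path can start. -/
def R12 (x : ℕ) : Prop :=
  (I.HdCond {.zeta .d} (x - 1) ∧
    (I.Pop (x - 1) ∧ I.Pop x → I.lab (.zeta .d) (I.ctx (x - 1)))) ∧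
  (I.HuCond {.zeta .u} x ∧
    (I.Pop (x - 1) ∧ I.Push x → I.lab (.zeta .u) x))

/-- The node `y` is pending as seen from the node `x`. -/
def Pending (x y : ℕ) : Prop :=
  (I.Push y ∧ ¬ ∃ z, z < x ∧ I.Pop z ∧ I.stack z = y) ∨
  (I.Shift y ∧ ¬ ∃ z, z < x ∧ I.Pop z ∧ I.stack z = I.stack y)

/-- Prune: a push or shift node has no pending equivalent ancestor. -/
def R13 (x : ℕ) : Prop :=
  I.Push x ∨ I.Shift x →
    ¬ ∃ y, 1 ≤ y ∧ y < x ∧ I.Pending x y ∧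
      (∀ s ∈ symSort φ, I.lab s x ↔ I.lab s y) ∧
      I.smb x = I.smb y ∧
      (∀ s ∈ symSort φ, I.lab s (I.stack x) ↔ I.lab s (I.stack y)) ∧
      (∀ s ∈ symSort φ, I.lab s (I.ctx x) ↔ I.lab s (I.ctx y))

/-- The `k`-unraveling of a formula `φ` in negation normal form. -/
def Unraveling (M : OPM Sg) : Prop :=
  I.Axioms ∧ I.Opm M ∧ I.Init ∧
  (∀ x, 1 ≤ x → x ≤ k →
    I.R2 x ∧ I.R3 x ∧ I.R4 x ∧ I.R5 x ∧ I.R6 x ∧ I.R7 x ∧ I.R8 x ∧ I.R9 x ∧ I.R10 x ∧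
      I.R11 x ∧ I.R12 x ∧ I.R13 x) ∧
  (∀ x, 1 ≤ x → x < k →
    (I.Push x ∨ I.Shift x ∨ I.Pop x) ∧
    (I.Push x → I.StepPush x) ∧ (I.Shift x → I.StepShift x) ∧ (I.Pop x → I.StepPop x))

/-- The acceptance condition `e(x)`. -/
def Accept (x : ℕ) : Prop :=
  I.lab .hash x ∧ I.stack x = 0

end Interp

/-- The conjunction of the `k`-unraveling of (the negation normal form of) `φ` and `e(k)` is
satisfiable. -/
def EncodingSatisfiable {Sg : Type u} {AP : Type v} (M : OPM Sg) (φ : Formula Sg AP) (k : ℕ) :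
    Prop :=
  ∃ I : Interp (nnf φ) k, I.Unraveling M ∧ I.Accept k

end POTL

/-!
The nodes of a model of the unraveling form a run of the operator precedence parser, and its last
node accepts. Up to the first accepting node the run reads a word: a push or a shift reads the
lookahead, while pops leave it unchanged, so that each word position corresponds to a block of
nodes, some pops followed by one push or shift. The label of a position is the common label of the
nodes in its block, and the claim is that this word satisfies `φ` in position `1`.

The combinatorial part forgets the labels (`ParserRun`). The invariants `ParserRun.Inv` say that
`stack`, `ctx` and the node `top` that read the topmost stack symbol really describe a stack.
It follows that `i` and `j` are the contexts of a chain exactly if some pop with left context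
`ctx z = node i` happens at lookahead position `j` (`chain_pos`, `exists_pop_of_chain`), and that
the relation between the contexts of a chain is the action of the node after this pop
(`rel_pos_iff`). Hence chains do not cross, a position yields precedence to every linked position
but the last, and positions inside a chain take precedence over its right context (`chainLaws`);
hierarchical successors are recognised by the actions around a pop (`exists_pop_of_hierNext_d`,
`exists_pop_of_hierNext_u` and their converses).

With the chains translated into pops, the step and non-rejection rules that mention a kind of next
formula become its semantic clause. Strong chain and hierarchical next formulas are fulfilled since
the stack is empty in the end, so that every block is popped (`popped_or_le_stack`). In this way the
labels are `LocallyConsistent` with the word.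

The truth lemma `LocallyConsistent.sat` lifts local consistency to all formulas in negation normal
form. For until and release formulas it follows their one-step unfoldings to the right. The
nontrivial point is that prefixing a step to a path yields a path: a summary step must be maximal
among the available chains, which holds because a downward summary path cannot leave a chain that it
has entered (`lt_of_isSummaryPath_d`), and all elements of a hierarchical path must share one
context, which holds because each element determines it. Finally, a formula is equivalent to its
negation normal form (`sat_nnfAux`), because until and release are dual: paths can be cut in any of
their elements.
-/

universe u v

namespace POTL

/-! ### Runs of the parser -/

/-- A run of the operator precedence parser on nodes `0, …, len`. In node `x` the parser sees the
lookahead `look x` and has the symbol `smb x` on top of its stack; `stack x` is the node that pushed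
the topmost block of the stack (`0` if the stack is empty), and `ctx x` the node that read the left
context of this block. The run stops in the first node with lookahead `#` and empty stack. -/
structure ParserRun {Sg : Type u} (M : OPM Sg) where
  len : ℕ
  len_pos : 0 < len
  look : ℕ → Option Sg
  smb : ℕ → Option Sg
  stack : ℕ → ℕ
  ctx : ℕ → ℕ
  look_zero : look 0 = none
  smb_zero : smb 0 = none
  smb_one : smb 1 = none
  stack_one : stack 1 = 0
  ctx_one : ctx 1 = 0
  look_len : look len = none
  stack_len : stack len = 0
  not_accept : ∀ x, 1 ≤ x → x < len → ¬ (look x = none ∧ stack x = 0)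
  prec_ne_none : ∀ x, 1 ≤ x → x < len → M.prec (smb x) (look x) ≠ none
  smb_succ : ∀ x, 1 ≤ x → x < len → M.prec (smb x) (look x) ≠ some PR.gt → smb (x + 1) = look x
  stack_push : ∀ x, 1 ≤ x → x < len → M.prec (smb x) (look x) = some PR.lt → stack (x + 1) = x
  ctx_push_zero : ∀ x, 1 ≤ x → x < len → M.prec (smb x) (look x) = some PR.lt → stack x = 0 →
    ctx (x + 1) = 0
  ctx_push : ∀ x, 1 ≤ x → x < len → M.prec (smb x) (look x) = some PR.lt → stack x ≠ 0 →
    M.prec (smb (x - 1)) (look (x - 1)) ≠ some PR.gt → ctx (x + 1) = x - 1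
  ctx_push_pop : ∀ x, 1 ≤ x → x < len → M.prec (smb x) (look x) = some PR.lt → stack x ≠ 0 →
    M.prec (smb (x - 1)) (look (x - 1)) = some PR.gt → ctx (x + 1) = ctx (x - 1)
  stack_shift : ∀ x, 1 ≤ x → x < len → M.prec (smb x) (look x) = some PR.eq →
    stack (x + 1) = stack x
  ctx_shift : ∀ x, 1 ≤ x → x < len → M.prec (smb x) (look x) = some PR.eq → ctx (x + 1) = ctx x
  look_pop : ∀ x, 1 ≤ x → x < len → M.prec (smb x) (look x) = some PR.gt → look (x + 1) = look x
  smb_pop : ∀ x, 1 ≤ x → x < len → M.prec (smb x) (look x) = some PR.gt →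
    smb (x + 1) = smb (stack x)
  stack_pop : ∀ x, 1 ≤ x → x < len → M.prec (smb x) (look x) = some PR.gt →
    stack (x + 1) = stack (stack x)
  ctx_pop : ∀ x, 1 ≤ x → x < len → M.prec (smb x) (look x) = some PR.gt →
    ctx (x + 1) = ctx (stack x)

namespace ParserRun

variable {Sg : Type u} {M : OPM Sg} (R : ParserRun M)

/-- The lookahead is read and opens a new block of the stack. -/
def Push (x : ℕ) : Prop := M.prec (R.smb x) (R.look x) = some PR.lt

/-- The lookahead is read and extends the topmost block of the stack. -/
def Shift (x : ℕ) : Prop := M.prec (R.smb x) (R.look x) = some PR.eq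

/-- The topmost block of the stack is removed; the lookahead is kept. -/
def Pop (x : ℕ) : Prop := M.prec (R.smb x) (R.look x) = some PR.gt

open Classical in
/-- The node that read the symbol on top of the stack of node `x`. -/
noncomputable def top (x : ℕ) : ℕ := if R.Pop (x - 1) then R.ctx (x - 1) else x - 1

open Classical in
/-- The word position of the lookahead of node `x`: the number of symbols read before `x`. -/
noncomputable def pos : ℕ → ℕ
  | 0 => 0
  | x + 1 => if R.Pop x then pos x else pos x + 1

variable {R}

theorem Push.not_pop {x : ℕ} (h : R.Push x) : ¬ R.Pop x := by
  unfold Push at h; unfold Pop; simp [h]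

theorem Shift.not_pop {x : ℕ} (h : R.Shift x) : ¬ R.Pop x := by
  unfold Shift at h; unfold Pop; simp [h]

theorem Push.not_shift {x : ℕ} (h : R.Push x) : ¬ R.Shift x := by
  unfold Push at h; unfold Shift; simp [h]

/-- Node `0`, where `#` meets `#`, counts as the shift that reads position `0`. -/
theorem shift_zero : R.Shift 0 := by
  simp [Shift, R.look_zero, R.smb_zero, OPM.prec]

theorem not_pop_of_smb {x : ℕ} (h : R.smb x = none) : ¬ R.Pop x := by
  unfold Pop; rw [h]; cases R.look x <;> simp [OPM.prec]

theorem push_or_shift_or_pop {x : ℕ} (h1 : 1 ≤ x) (hx : x < R.len) :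
    R.Push x ∨ R.Shift x ∨ R.Pop x := by
  have := R.prec_ne_none x h1 hx
  unfold Push Shift Pop
  rcases h : M.prec (R.smb x) (R.look x) with _ | r
  · exact absurd h this
  · cases r <;> simp

theorem top_succ_of_pop {x : ℕ} (h : R.Pop x) : R.top (x + 1) = R.ctx x := by
  simp [top, h]

theorem top_succ_of_not_pop {x : ℕ} (h : ¬ R.Pop x) : R.top (x + 1) = x := by
  simp [top, h]

theorem pos_succ_of_pop {x : ℕ} (h : R.Pop x) : R.pos (x + 1) = R.pos x := by
  simp [pos, h]

theorem pos_succ_of_not_pop {x : ℕ} (h : ¬ R.Pop x) : R.pos (x + 1) = R.pos x + 1 := by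
  simp [pos, h]

/-! ### Invariants of a run -/

variable (R) in
/-- What the parser maintains in node `x`. The last two fields say that the stack below its topmost
block, and the stack up to its topmost symbol, are left untouched as long as they are needed. -/
structure Inv (x : ℕ) : Prop where
  top_lt : R.top x < x
  not_pop_top : ¬ R.Pop (R.top x)
  smb_eq : R.smb x = R.look (R.top x)
  ctx_eq : R.ctx x = R.ctx (R.top x + 1)
  stack_eq : R.stack x = R.stack (R.top x + 1)
  top_eq_zero : R.stack x = 0 → R.top x = 0
  ctx_eq_zero : R.stack x = 0 → R.ctx x = 0
  stack_lt : R.stack x < x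
  push_stack : R.stack x ≠ 0 → R.Push (R.stack x)
  top_stack : R.stack x ≠ 0 → R.top (R.stack x) = R.ctx x
  stack_le_top : R.stack x ≤ R.top x
  stack_le : ∀ y, R.stack x < y → y ≤ x → R.stack x ≤ R.top y ∧ R.stack x ≤ R.stack y
  top_le : ∀ y, R.top x < y → y ≤ x → R.top x ≤ R.top y

theorem top_one : R.top 1 = 0 := by
  simpa using top_succ_of_not_pop (R := R) (x := 0) shift_zero.not_pop

theorem inv_one : R.Inv 1 where
  top_lt := by rw [top_one]; omega
  not_pop_top := by rw [top_one]; exact shift_zero.not_pop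
  smb_eq := by rw [top_one, R.smb_one, R.look_zero]
  ctx_eq := by rw [top_one]
  stack_eq := by rw [top_one]
  top_eq_zero _ := top_one
  ctx_eq_zero _ := R.ctx_one
  stack_lt := by rw [R.stack_one]; omega
  push_stack h := absurd R.stack_one h
  top_stack h := absurd R.stack_one h
  stack_le_top := by rw [R.stack_one]; omega
  stack_le y _ _ := by rw [R.stack_one]; omega
  top_le y _ _ := by rw [top_one]; omega

theorem Inv.stack_ne_zero_of_shift {x : ℕ} (hI : R.Inv x) (h1 : 1 ≤ x) (hx : x < R.len)
    (h : R.Shift x) : R.stack x ≠ 0 := by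
  intro h0
  have hs : R.smb x = none := by rw [hI.smb_eq, hI.top_eq_zero h0, R.look_zero]
  refine R.not_accept x h1 hx ⟨?_, h0⟩
  unfold Shift at h
  rw [hs] at h
  rcases hl : R.look x with _ | a
  · rfl
  · simp [hl, OPM.prec] at h

theorem Inv.stack_ne_zero_of_pop {x : ℕ} (hI : R.Inv x) (h : R.Pop x) : R.stack x ≠ 0 := by
  intro h0
  exact not_pop_of_smb (by rw [hI.smb_eq, hI.top_eq_zero h0, R.look_zero]) h

theorem Inv.ctx_succ_of_push {x : ℕ} (hI : R.Inv x) (h1 : 1 ≤ x) (hx : x < R.len)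
    (h : R.Push x) : R.ctx (x + 1) = R.top x := by
  by_cases h0 : R.stack x = 0
  · rw [R.ctx_push_zero x h1 hx h h0, hI.top_eq_zero h0]
  · by_cases hp : R.Pop (x - 1)
    · rw [R.ctx_push_pop x h1 hx h h0 hp]; simp [top, hp]
    · rw [R.ctx_push x h1 hx h h0 hp]; simp [top, hp]

theorem Inv.succ_of_push {x : ℕ} (hI : R.Inv x) (h1 : 1 ≤ x) (hx : x < R.len)
    (h : R.Push x) : R.Inv (x + 1) := by
  have ht := top_succ_of_not_pop h.not_pop
  have hs := R.stack_push x h1 hx h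
  have hc := hI.ctx_succ_of_push h1 hx h
  constructor
  · omega
  · rw [ht]; exact h.not_pop
  · rw [ht]; exact R.smb_succ x h1 hx h.not_pop
  · rw [ht]
  · rw [ht]
  · omega
  · omega
  · omega
  · intro _; rwa [hs]
  · intro _; rw [hs, hc]
  · omega
  · intro y h2 h3
    obtain rfl : y = x + 1 := by omega
    omega
  · intro y h2 h3
    obtain rfl : y = x + 1 := by omega
    omega

theorem Inv.succ_of_shift {x : ℕ} (hI : R.Inv x) (h1 : 1 ≤ x) (hx : x < R.len)
    (h : R.Shift x) : R.Inv (x + 1) := by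
  have ht := top_succ_of_not_pop h.not_pop
  have hs := R.stack_shift x h1 hx h
  have hc := R.ctx_shift x h1 hx h
  have h0 := hI.stack_ne_zero_of_shift h1 hx h
  have hlt := hI.stack_lt
  constructor
  · omega
  · rw [ht]; exact h.not_pop
  · rw [ht]; exact R.smb_succ x h1 hx h.not_pop
  · rw [ht]
  · rw [ht]
  · omega
  · omega
  · omega
  · intro _; rw [hs]; exact hI.push_stack h0
  · intro _; rw [hs, hc]; exact hI.top_stack h0
  · omega
  · intro y h2 h3
    rcases Nat.lt_or_ge x y with h4 | h4
    · obtain rfl : y = x + 1 := by omega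
      omega
    · rw [hs]; exact hI.stack_le y (by omega) h4
  · intro y h2 h3
    obtain rfl : y = x + 1 := by omega
    omega

theorem Inv.succ_of_pop {x : ℕ} (hI : R.Inv x) (hJ : R.Inv (R.stack x)) (h1 : 1 ≤ x)
    (hx : x < R.len) (h : R.Pop x) : R.Inv (x + 1) := by
  have h0 := hI.stack_ne_zero_of_pop h
  have hlt := hI.stack_lt
  have ht : R.top (x + 1) = R.top (R.stack x) := by
    rw [top_succ_of_pop h, hI.top_stack h0]
  have hs := R.stack_pop x h1 hx h
  have hc := R.ctx_pop x h1 hx h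
  have hlt' := hJ.stack_lt
  have htl' := hJ.top_lt
  have hst' := hJ.stack_le_top
  constructor
  · omega
  · rw [ht]; exact hJ.not_pop_top
  · rw [ht, R.smb_pop x h1 hx h]; exact hJ.smb_eq
  · rw [ht, hc]; exact hJ.ctx_eq
  · rw [ht, hs]; exact hJ.stack_eq
  · rw [ht, hs]; exact hJ.top_eq_zero
  · rw [hc, hs]; exact hJ.ctx_eq_zero
  · omega
  · rw [hs]; exact hJ.push_stack
  · rw [hs, hc]; exact hJ.top_stack
  · omega
  · intro y h2 h3
    rw [hs] at h2 ⊢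
    rcases Nat.lt_or_ge x y with h4 | h4
    · obtain rfl : y = x + 1 := by omega
      omega
    · rcases Nat.lt_or_ge (R.stack x) y with h5 | h5
      · have := hI.stack_le y h5 h4
        omega
      · exact hJ.stack_le y h2 h5
  · intro y h2 h3
    rw [ht] at h2 ⊢
    rcases Nat.lt_or_ge x y with h4 | h4
    · obtain rfl : y = x + 1 := by omega
      omega
    · rcases Nat.lt_or_ge (R.stack x) y with h5 | h5
      · have := hI.stack_le y h5 h4
        omega
      · exact hJ.top_le y h2 h5

theorem inv {x : ℕ} (h1 : 1 ≤ x) (hx : x ≤ R.len) : R.Inv x := by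
  induction x using Nat.strong_induction_on with
  | _ x ih =>
    obtain ⟨y, rfl⟩ : ∃ y, x = y + 1 := ⟨x - 1, by omega⟩
    by_cases hy : y = 0
    · subst hy; exact inv_one
    · have hI := ih y (by omega) (by omega) (by omega)
      rcases push_or_shift_or_pop (R := R) (x := y) (by omega) (by omega) with h | h | h
      · exact hI.succ_of_push (by omega) hx h
      · exact hI.succ_of_shift (by omega) hx h
      · have h0 := hI.stack_ne_zero_of_pop h
        have := hI.stack_lt
        exact hI.succ_of_pop (ih _ (by omega) (by omega) (by omega)) (by omega) hx h

theorem shift_len : R.Shift R.len := by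
  have hI := inv (R := R) R.len_pos le_rfl
  have : R.smb R.len = none := by
    rw [hI.smb_eq, hI.top_eq_zero R.stack_len, R.look_zero]
  simp [Shift, this, R.look_len, OPM.prec]

theorem Pop.pos {x : ℕ} (h : R.Pop x) : 1 ≤ x := by
  rcases Nat.eq_zero_or_pos x with rfl | h0
  · exact absurd h shift_zero.not_pop
  · exact h0

theorem Pop.lt_len {x : ℕ} (h : R.Pop x) (hx : x ≤ R.len) : x < R.len := by
  rcases hx.eq_or_lt with rfl | h0
  · exact absurd h shift_len.not_pop
  · exact h0

theorem Push.pos {x : ℕ} (h : R.Push x) : 1 ≤ x := by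
  rcases Nat.eq_zero_or_pos x with rfl | h0
  · exact absurd shift_zero h.not_shift
  · exact h0

theorem Push.lt_len {x : ℕ} (h : R.Push x) (hx : x ≤ R.len) : x < R.len := by
  rcases hx.eq_or_lt with rfl | h0
  · exact absurd shift_len h.not_shift
  · exact h0

theorem Pop.inv {x : ℕ} (h : R.Pop x) (hx : x ≤ R.len) : R.Inv x := ParserRun.inv h.pos hx

theorem Pop.stack_ne_zero {x : ℕ} (h : R.Pop x) (hx : x ≤ R.len) : R.stack x ≠ 0 :=
  (h.inv hx).stack_ne_zero_of_pop h

/-- No symbol is read with lookahead `#`. -/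
theorem look_ne_none {x : ℕ} (h1 : 1 ≤ x) (hx : x < R.len) (h : ¬ R.Pop x) :
    R.look x ≠ none := by
  induction x using Nat.strong_induction_on with
  | _ x ih =>
    intro hl
    have hI := inv (R := R) h1 hx.le
    have h0 : R.stack x ≠ 0 := fun h0 => R.not_accept x h1 hx ⟨hl, h0⟩
    have := hI.stack_le_top
    have hlt := hI.top_lt
    have ht := ih _ hlt (by omega) (by omega) hI.not_pop_top
    apply h
    unfold Pop
    rw [hI.smb_eq, hl]
    rcases hh : R.look (R.top x) with _ | a
    · exact absurd hh ht
    · simp [OPM.prec]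

/-! ### Blocks of the stack -/

/-- A block that is on the stack in node `w` stays there until it is popped. -/
theorem popped_or_le_stack {w : ℕ} (hw : 1 ≤ w) {x : ℕ} (hwx : w ≤ x) (hx : x ≤ R.len) :
    (∃ z, w ≤ z ∧ z < x ∧ R.Pop z ∧ R.stack z = R.stack w) ∨ R.stack w ≤ R.stack x := by
  induction x using Nat.strong_induction_on with
  | _ x ih =>
    rcases hwx.eq_or_lt with rfl | hlt
    · exact Or.inr le_rfl
    obtain ⟨y, rfl⟩ : ∃ y, x = y + 1 := ⟨x - 1, by omega⟩
    rcases ih y (by omega) (by omega) (by omega) with ⟨z, h1, h2, h3, h4⟩ | hle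
    · exact Or.inl ⟨z, h1, by omega, h3, h4⟩
    have hIw := inv (R := R) hw (by omega)
    have hI := inv (R := R) (x := y) (by omega) (by omega)
    have hy := hI.stack_lt
    rcases push_or_shift_or_pop (R := R) (x := y) (by omega) (by omega) with h | h | h
    · right
      rw [R.stack_push y (by omega) hx h]; omega
    · right
      rw [R.stack_shift y (by omega) hx h]; exact hle
    · rcases hle.eq_or_lt with heq | hlt2
      · exact Or.inl ⟨y, by omega, by omega, h, heq.symm⟩
      · rw [R.stack_pop y (by omega) hx h]
        rcases Nat.lt_or_ge (R.stack y) w with h5 | h5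
        · exact Or.inr (hIw.stack_le _ hlt2 h5.le).2
        · rcases ih (R.stack y) (by omega) h5 (by omega) with ⟨z, h1, h2, h3, h4⟩ | hle
          · exact Or.inl ⟨z, h1, by omega, h3, h4⟩
          · exact Or.inr hle

theorem exists_pop_of_stack_ne_zero {w : ℕ} (hw : 1 ≤ w) (hl : w ≤ R.len)
    (h0 : R.stack w ≠ 0) : ∃ z, w ≤ z ∧ z < R.len ∧ R.Pop z ∧ R.stack z = R.stack w := by
  rcases popped_or_le_stack hw hl le_rfl with h | h
  · exact h
  · rw [R.stack_len] at h; omega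

theorem Push.exists_pop {y : ℕ} (h : R.Push y) (hy : y < R.len) :
    ∃ z, y < z ∧ z < R.len ∧ R.Pop z ∧ R.stack z = y := by
  have hs := R.stack_push y h.pos hy h
  obtain ⟨z, h1, h2, h3, h4⟩ := exists_pop_of_stack_ne_zero (R := R) (w := y + 1) (by omega) hy
    (by have := h.pos; omega)
  exact ⟨z, by omega, h2, h3, by omega⟩

theorem Shift.exists_pop {y : ℕ} (h : R.Shift y) (h1 : 1 ≤ y) (hy : y < R.len) :
    ∃ z, y < z ∧ z < R.len ∧ R.Pop z ∧ R.stack z = R.stack y := by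
  have hs := R.stack_shift y h1 hy h
  obtain ⟨z, h1, h2, h3, h4⟩ := exists_pop_of_stack_ne_zero (R := R) (w := y + 1) (by omega) hy
    (by rw [hs]; exact (inv h1 hy.le).stack_ne_zero_of_shift h1 hy h)
  exact ⟨z, by omega, h2, h3, by omega⟩

theorem Pop.ctx_lt_stack {z : ℕ} (h : R.Pop z) (hz : z ≤ R.len) : R.ctx z < R.stack z := by
  have hI := h.inv hz
  have h0 := h.stack_ne_zero hz
  have hJ := ParserRun.inv (R := R) (x := R.stack z) (by omega) (hI.stack_lt.le.trans hz)
  rw [← hI.top_stack h0]; exact hJ.top_lt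

/-- A block is popped only once. -/
theorem Pop.eq_of_stack_eq {z z' : ℕ} (h : R.Pop z) (h' : R.Pop z') (hz : z ≤ R.len)
    (hz' : z' ≤ R.len) (hs : R.stack z = R.stack z') : z = z' := by
  wlog hlt : z < z' generalizing z z'
  · rcases Nat.lt_trichotomy z z' with h1 | h1 | h1
    · exact absurd h1 hlt
    · exact h1
    · exact (this h' h hz' hz hs.symm h1).symm
  exfalso
  have hI := h.inv hz
  have h0 := h.stack_ne_zero hz
  have h1 := hI.stack_lt
  have h2 := (ParserRun.inv (R := R) (x := R.stack z) (by omega) (by omega)).stack_lt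
  have h3 := ((h'.inv hz').stack_le (z + 1) (by omega) (by omega)).2
  rw [R.stack_pop z h.pos (h.lt_len hz) h] at h3
  omega

/-- Between two nodes with the same topmost stack symbol, the lookahead of the first one is pushed
and its block is popped. -/
theorem exists_pop_of_top_eq {x x' : ℕ} (h1 : 1 ≤ x) (hlt : x < x') (hx' : x' ≤ R.len)
    (ht : R.top x = R.top x') :
    R.Push x ∧ ∃ z, x < z ∧ z < x' ∧ R.Pop z ∧ R.stack z = x := by
  induction x' using Nat.strong_induction_on with
  | _ x' ih =>
    obtain ⟨z, rfl⟩ : ∃ z, x' = z + 1 := ⟨x' - 1, by omega⟩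
    have hI := inv (R := R) h1 (by omega)
    have hxt := hI.top_lt
    by_cases hz : R.Pop z
    · have hIz := hz.inv (by omega)
      have h0 := hz.stack_ne_zero (by omega)
      have hsz := hIz.stack_lt
      have hc := hz.ctx_lt_stack (by omega)
      rw [top_succ_of_pop hz] at ht
      have hts := hIz.top_stack h0
      rcases Nat.lt_trichotomy x (R.stack z) with h2 | h2 | h2
      · obtain ⟨h3, y, h4, h5, h6⟩ := ih _ (by omega) h2 (by omega) (by omega)
        exact ⟨h3, y, h4, by omega, h6⟩
      · refine ⟨?_, z, by omega, by omega, hz, h2.symm⟩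
        rw [h2]; exact hIz.push_stack h0
      · have := (hIz.stack_le x h2 (by omega)).1
        omega
    · rw [top_succ_of_not_pop hz] at ht
      omega

/-! ### Word positions of nodes -/

theorem pos_mono : Monotone R.pos := by
  refine monotone_nat_of_le_succ fun x => ?_
  by_cases h : R.Pop x
  · rw [pos_succ_of_pop h]
  · rw [pos_succ_of_not_pop h]; omega

theorem pos_lt_of_not_pop {x y : ℕ} (hx : ¬ R.Pop x) (hlt : x < y) : R.pos x < R.pos y := by
  have := pos_mono (R := R) hlt
  rw [Nat.succ_eq_add_one, pos_succ_of_not_pop hx] at this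
  omega

theorem pop_of_pos_eq {x y : ℕ} (h : R.pos x = R.pos y) (hlt : x < y) : R.Pop x := by
  by_contra hx
  have := pos_lt_of_not_pop hx hlt
  omega

theorem lt_of_pos_lt {x y : ℕ} (h : R.pos x < R.pos y) : x < y := by
  by_contra hx
  have := pos_mono (R := R) (Nat.le_of_not_lt hx)
  omega

theorem look_eq_of_pos_eq {x y : ℕ} (hle : x ≤ y) (hy : y ≤ R.len) (h : R.pos x = R.pos y) :
    R.look x = R.look y := by
  induction y, hle using Nat.le_induction with
  | base => rfl
  | succ y hle ih =>
    have hp : R.Pop y := pop_of_pos_eq (R := R) (y := y + 1) (by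
      have h1 := pos_mono (R := R) hle
      have h2 := pos_mono (R := R) (Nat.le_succ y)
      simp only [Nat.succ_eq_add_one] at h2
      omega) (by omega)
    rw [pos_succ_of_pop hp] at h
    rw [ih (by omega) h, R.look_pop y hp.pos hy hp]

/-- Nodes with the same lookahead position expose symbols ever deeper in the stack. -/
theorem top_lt_top {x y : ℕ} (hlt : x < y) (hy : y ≤ R.len) (h : R.pos x = R.pos y) :
    R.top y < R.top x := by
  induction y, hlt using Nat.le_induction with
  | base =>
    have hp := pop_of_pos_eq h (Nat.lt_succ_self x)
    rw [Nat.succ_eq_add_one, top_succ_of_pop hp]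
    exact (hp.ctx_lt_stack (by omega)).trans_le (hp.inv (by omega)).stack_le_top
  | succ y hle ih =>
    have hp : R.Pop y := pop_of_pos_eq (R := R) (y := y + 1) (by
      have h1 := pos_mono (R := R) (show x ≤ y by omega)
      have h2 := pos_mono (R := R) (Nat.le_succ y)
      simp only [Nat.succ_eq_add_one] at h2
      omega) (by omega)
    rw [pos_succ_of_pop hp] at h
    have h1 := ih (by omega) h
    rw [top_succ_of_pop hp]
    have := hp.ctx_lt_stack (by omega)
    have := (hp.inv (by omega)).stack_le_top
    omega

variable (R) in
/-- The node that reads the word position `p` (the final node for the last position). -/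
noncomputable def node (p : ℕ) : ℕ := Nat.findGreatest (fun x => R.pos x = p) R.len

theorem node_le (p : ℕ) : R.node p ≤ R.len := Nat.findGreatest_le _

theorem exists_pos_eq {p x : ℕ} (hp : p ≤ R.pos x) : ∃ y ≤ x, R.pos y = p := by
  induction x with
  | zero => exact ⟨0, le_rfl, by simp [pos] at hp ⊢; omega⟩
  | succ x ih =>
    rcases hp.eq_or_lt with h | h
    · exact ⟨x + 1, le_rfl, h.symm⟩
    · have : p ≤ R.pos x := by
        by_cases hx : R.Pop x
        · rw [pos_succ_of_pop hx] at h; omega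
        · rw [pos_succ_of_not_pop hx] at h; omega
      obtain ⟨y, h1, h2⟩ := ih this
      exact ⟨y, by omega, h2⟩

theorem pos_node {p : ℕ} (hp : p ≤ R.pos R.len) : R.pos (R.node p) = p := by
  obtain ⟨y, h1, h2⟩ := exists_pos_eq hp
  exact Nat.findGreatest_spec (P := fun x => R.pos x = p) h1 h2

theorem le_node {x : ℕ} (hx : x ≤ R.len) : x ≤ R.node (R.pos x) :=
  Nat.le_findGreatest hx rfl

theorem node_pos {x : ℕ} (hx : x ≤ R.len) (h : ¬ R.Pop x) : R.node (R.pos x) = x := by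
  by_contra hne
  have h1 := le_node hx
  exact h (pop_of_pos_eq (pos_node (pos_mono hx)).symm (by omega))

theorem not_pop_node {p : ℕ} (hp : p ≤ R.pos R.len) : ¬ R.Pop (R.node p) := by
  intro h
  have hlt := h.lt_len (node_le p)
  have h1 := pos_succ_of_pop h
  have h2 := le_node (R := R) (x := R.node p + 1) hlt
  rw [h1, pos_node hp] at h2
  omega

theorem node_last : R.node (R.pos R.len) = R.len := node_pos le_rfl shift_len.not_pop

theorem node_zero : R.node 0 = 0 := by
  have := node_pos (R := R) (x := 0) (by omega) shift_zero.not_pop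
  simpa [pos] using this

theorem node_lt_node {p q : ℕ} (h : p < q) (hq : q ≤ R.pos R.len) : R.node p < R.node q :=
  lt_of_pos_lt (by rw [pos_node hq, pos_node (h.le.trans hq)]; exact h)

theorem node_lt_len {p : ℕ} (hp : p < R.pos R.len) : R.node p < R.len :=
  lt_of_pos_lt (by rw [pos_node hp.le]; exact hp)

theorem one_le_node {p : ℕ} (h : 1 ≤ p) (hp : p ≤ R.pos R.len) : 1 ≤ R.node p := by
  have := node_lt_node h hp; omega

theorem pos_lt_last {x : ℕ} (hx : x < R.len) (h : ¬ R.Pop x) : R.pos x < R.pos R.len :=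
  pos_lt_of_not_pop h hx

theorem pos_one : R.pos 1 = 1 := by
  simpa [pos] using pos_succ_of_not_pop (R := R) (x := 0) shift_zero.not_pop

theorem one_le_pos {x : ℕ} (h : 1 ≤ x) : 1 ≤ R.pos x := by
  have := pos_mono (R := R) h
  rwa [pos_one] at this

end ParserRun

namespace ParserRun

variable {Sg : Type u} {M : OPM Sg} {R : ParserRun M}

/-! ### The word read by a run and its chains -/

variable (R) in
/-- The symbol in position `p` of the word that is read by a run. -/
noncomputable def sym (p : ℕ) : Option Sg := R.look (R.node p)

theorem sym_pos {x : ℕ} (hx : x ≤ R.len) : R.sym (R.pos x) = R.look x :=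
  (look_eq_of_pos_eq (le_node hx) (node_le _) (pos_node (pos_mono hx)).symm).symm

theorem prec_sym_pos {x : ℕ} (h1 : 1 ≤ x) (hx : x ≤ R.len) :
    M.prec (R.sym (R.pos (R.top x))) (R.sym (R.pos x)) = M.prec (R.smb x) (R.look x) := by
  have hI := inv h1 hx
  rw [sym_pos hx, sym_pos (hI.top_lt.le.trans hx), hI.smb_eq]

/-- The stack of a node consists of initial parts of chains that are still open, and its topmost
symbol is linked with the lookahead. -/
theorem link_and_body_of_node {x : ℕ} (h1 : 1 ≤ x) (hx : x ≤ R.len) :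
    ChainPart M R.sym .link (R.pos (R.top x)) (R.pos x) ∧
      (R.stack x ≠ 0 → ChainPart M R.sym .body (R.pos (R.ctx x)) (R.pos (R.top x))) := by
  induction x using Nat.strong_induction_on with
  | _ x ih =>
    obtain ⟨y, rfl⟩ : ∃ y, x = y + 1 := ⟨x - 1, by omega⟩
    by_cases hy : y = 0
    · subst hy
      rw [Nat.zero_add, top_one, pos_one, R.stack_one]
      exact ⟨.adjacent 0, fun h => absurd rfl h⟩
    have hy1 : 1 ≤ y := by omega
    have hI := inv (R := R) hy1 (by omega)
    obtain ⟨hl, hb⟩ := ih y (by omega) hy1 (by omega)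
    have hp := prec_sym_pos (R := R) hy1 (by omega)
    rcases push_or_shift_or_pop (R := R) hy1 (by omega) with h | h | h
    · rw [top_succ_of_not_pop h.not_pop, pos_succ_of_not_pop h.not_pop,
        hI.ctx_succ_of_push hy1 hx h]
      exact ⟨.adjacent _, fun _ => .first hl (hp.trans h)⟩
    · rw [top_succ_of_not_pop h.not_pop, pos_succ_of_not_pop h.not_pop, R.ctx_shift y hy1 hx h]
      exact ⟨.adjacent _, fun _ =>
        .next (hb (hI.stack_ne_zero_of_shift hy1 hx h)) hl (hp.trans h)⟩
    · have h0 := hI.stack_ne_zero_of_pop h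
      have := hI.stack_lt
      rw [top_succ_of_pop h, pos_succ_of_pop h, R.stack_pop y hy1 hx h, R.ctx_pop y hy1 hx h]
      refine ⟨.nested (.close (hb h0) hl (hp.trans h)), fun h2 => ?_⟩
      rw [← hI.top_stack h0]
      exact (ih _ (by omega) (by omega) (by omega)).2 h2

theorem chain_of_pop {z : ℕ} (h : R.Pop z) (hz : z ≤ R.len) :
    ChainPart M R.sym .chain (R.pos (R.ctx z)) (R.pos z) := by
  obtain ⟨hl, hb⟩ := link_and_body_of_node h.pos hz
  exact .close (hb (h.stack_ne_zero hz)) hl ((prec_sym_pos h.pos hz).trans h)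

end ParserRun

theorem ChainPart.lt {Sg : Type u} {M : OPM Sg} {sym : ℕ → Option Sg} {κ : ChainKind} {i j : ℕ}
    (h : ChainPart M sym κ i j) : i < j := by
  induction h <;> omega

theorem ChainPart.succ_lt {Sg : Type u} {M : OPM Sg} {sym : ℕ → Option Sg} {i j : ℕ}
    (h : ChainPart M sym .chain i j) : i + 1 < j := by
  cases h with
  | close hb hl hr =>
    have := hb.lt
    have := hl.lt
    omega

namespace ParserRun

variable {Sg : Type u} {M : OPM Sg} {R : ParserRun M}

/-- What a link, an initial part of a chain or a chain of the word means for the run. -/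
def Trace (R : ParserRun M) : ChainKind → ℕ → ℕ → Prop
  | .link, i, j => ∃ x, 1 ≤ x ∧ x ≤ R.len ∧ R.pos x = j ∧ R.top x = R.node i
  | .body, i, p => 1 ≤ p ∧ p < R.pos R.len ∧ R.ctx (R.node p + 1) = R.node i
  | .chain, i, j => ∃ z, z < R.len ∧ R.Pop z ∧ R.pos z = j ∧ R.ctx z = R.node i

/-- Every link, initial part and chain of the word is traversed by the parser; converse of
`link_and_body_of_node`. -/
theorem trace_of_chainPart {κ : ChainKind} {i j : ℕ} (h : ChainPart M R.sym κ i j)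
    (hj : j ≤ R.pos R.len) : R.Trace κ i j := by
  induction h with
  | adjacent i =>
    have hn := not_pop_node (R := R) (p := i) (by omega)
    exact ⟨R.node i + 1, by omega, node_lt_len hj,
      by rw [pos_succ_of_not_pop hn, pos_node (by omega)], top_succ_of_not_pop hn⟩
  | nested h ih =>
    obtain ⟨z, hz, hp, h1, h2⟩ := ih hj
    exact ⟨z + 1, by omega, hz, by rw [pos_succ_of_pop hp, h1], by rw [top_succ_of_pop hp, h2]⟩
  | @first i p h hr ih =>
    obtain ⟨x, hx1, hx, rfl, ht⟩ := ih hj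
    have hi : R.pos (R.top x) = i := by rw [ht, pos_node (h.lt.le.trans hj)]
    rw [← hi, prec_sym_pos hx1 hx] at hr
    change R.Push x at hr
    have hlt := hr.lt_len hx
    refine ⟨one_le_pos hx1, pos_lt_last hlt hr.not_pop, ?_⟩
    rw [node_pos hx hr.not_pop, (inv hx1 hx).ctx_succ_of_push hx1 hlt hr, ht]
  | @next i p q hb hl hr ihb ihl =>
    obtain ⟨x, hx1, hx, rfl, ht⟩ := ihl hj
    have hpq := hl.lt
    obtain ⟨hp1, hp2, hc⟩ := ihb (by omega)
    have hI := inv (R := R) hx1 hx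
    have hi : R.pos (R.top x) = p := by rw [ht, pos_node hp2.le]
    rw [← hi, prec_sym_pos hx1 hx] at hr
    change R.Shift x at hr
    have hlt : x < R.len := by
      refine lt_of_le_of_ne hx ?_
      rintro rfl
      have := one_le_node (R := R) hp1 hp2.le
      have := hI.top_eq_zero R.stack_len
      omega
    refine ⟨one_le_pos hx1, pos_lt_last hlt hr.not_pop, ?_⟩
    rw [node_pos hx hr.not_pop, R.ctx_shift x hx1 hlt hr, hI.ctx_eq, ht, hc]
  | @close i p j hb hl hr ihb ihl =>
    obtain ⟨x, hx1, hx, rfl, ht⟩ := ihl hj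
    have hpq := hl.lt
    obtain ⟨hp1, hp2, hc⟩ := ihb (by omega)
    have hI := inv (R := R) hx1 hx
    have hi : R.pos (R.top x) = p := by rw [ht, pos_node hp2.le]
    rw [← hi, prec_sym_pos hx1 hx] at hr
    change R.Pop x at hr
    exact ⟨x, hr.lt_len hx, hr, rfl, by rw [hI.ctx_eq, ht, hc]⟩

theorem prec_ne_none_of_le {x : ℕ} (h1 : 1 ≤ x) (hx : x ≤ R.len) :
    M.prec (R.smb x) (R.look x) ≠ none := by
  rcases hx.eq_or_lt with rfl | h
  · have : R.Shift R.len := shift_len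
    unfold Shift at this
    simp [this]
  · exact R.prec_ne_none x h1 h

theorem prec_sym_ne_none_of_link {i j : ℕ} (h : ChainPart M R.sym .link i j)
    (hj : j ≤ R.pos R.len) : M.prec (R.sym i) (R.sym j) ≠ none := by
  obtain ⟨x, hx1, hx, rfl, ht⟩ := trace_of_chainPart h hj
  have hi : R.pos (R.top x) = i := by rw [ht, pos_node (h.lt.le.trans hj)]
  rw [← hi, prec_sym_pos hx1 hx]
  exact prec_ne_none_of_le hx1 hx

variable (R) in
/-- The OP word read by a run, with given sets of atomic propositions. -/
noncomputable def toWord {AP : Type v} (lab : ℕ → Set AP) : OPWord M AP where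
  last := R.pos R.len
  last_pos := one_le_pos R.len_pos
  sym := R.sym
  lab := lab
  sym_zero := by rw [sym, node_zero, R.look_zero]
  sym_last := by rw [sym, node_last, R.look_len]
  sym_inner i h0 h := look_ne_none (one_le_node h0 h.le) (node_lt_len h) (not_pop_node h.le)
  compat_adjacent i h := prec_sym_ne_none_of_link (.adjacent i) h
  compat_chain i j hj h := prec_sym_ne_none_of_link (.nested h) hj

/-! ### Chains as pops -/

variable {AP : Type v} {lab : ℕ → Set AP}

theorem rel_iff {r : PR} {x : ℕ} (h1 : 1 ≤ x) (hx : x ≤ R.len) :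
    (R.toWord lab).Rel r (R.pos (R.top x)) (R.pos x) ↔ M.prec (R.smb x) (R.look x) = some r := by
  rw [← prec_sym_pos h1 hx]; rfl

theorem rel_iff_of_top_eq {r : PR} {x i : ℕ} (h1 : 1 ≤ x) (hx : x ≤ R.len)
    (hi : i ≤ R.pos R.len) (ht : R.top x = R.node i) :
    (R.toWord lab).Rel r i (R.pos x) ↔ M.prec (R.smb x) (R.look x) = some r := by
  rw [← rel_iff (lab := lab) h1 hx, ht, pos_node hi]

theorem chain_pos {z : ℕ} (h : R.Pop z) (hz : z ≤ R.len) :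
    (R.toWord lab).Chain (R.pos (R.ctx z)) (R.pos z) :=
  ⟨pos_mono hz, chain_of_pop h hz⟩

/-- The relation between the contexts of a chain is decided in the node after its pop. -/
theorem rel_pos_iff {r : PR} {z : ℕ} (h : R.Pop z) (hz : z ≤ R.len) :
    (R.toWord lab).Rel r (R.pos (R.ctx z)) (R.pos z) ↔
      M.prec (R.smb (z + 1)) (R.look (z + 1)) = some r := by
  rw [← rel_iff (lab := lab) (by omega) (h.lt_len hz), top_succ_of_pop h, pos_succ_of_pop h]

theorem exists_pop_of_chain {i j : ℕ} (h : (R.toWord lab).Chain i j) :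
    ∃ z, z < R.len ∧ R.Pop z ∧ R.pos z = j ∧ R.ctx z = R.node i :=
  trace_of_chainPart h.2 h.1

theorem not_pop_ctx {z : ℕ} (h : R.Pop z) (hz : z ≤ R.len) : ¬ R.Pop (R.ctx z) := by
  rw [← top_succ_of_pop h]
  exact (inv (by omega) (h.lt_len hz)).not_pop_top

theorem node_pos_ctx {z : ℕ} (h : R.Pop z) (hz : z ≤ R.len) : R.node (R.pos (R.ctx z)) = R.ctx z :=
  node_pos (((h.ctx_lt_stack hz).trans (h.inv hz).stack_lt).le.trans hz) (not_pop_ctx h hz)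

end ParserRun

namespace OPWord

variable {Sg : Type u} {M : OPM Sg} {AP : Type v} {w : OPWord M AP}

theorem Rel.unique {r r' : PR} {i j : ℕ} (h : w.Rel r i j) (h' : w.Rel r' i j) : r = r' := by
  unfold Rel at h h'
  rw [h] at h'
  exact Option.some.inj h'

/-- `i` and `j` are adjacent positions or the contexts of a chain. -/
def Link (w : OPWord M AP) (i j : ℕ) : Prop :=
  j ≤ w.last ∧ ChainPart M w.sym .link i j

theorem Chain.link {i j : ℕ} (h : w.Chain i j) : w.Link i j :=
  ⟨h.1, .nested h.2⟩

theorem link_succ {i : ℕ} (h : i < w.last) : w.Link i (i + 1) :=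
  ⟨h, .adjacent i⟩

theorem Link.lt {i j : ℕ} (h : w.Link i j) : i < j := h.2.lt

theorem Chain.lt {i j : ℕ} (h : w.Chain i j) : i < j := h.2.lt

theorem Link.exists_rel {i j : ℕ} (h : w.Link i j) :
    w.Rel PR.lt i j ∨ w.Rel PR.eq i j ∨ w.Rel PR.gt i j := by
  have : M.prec (w.sym i) (w.sym j) ≠ none := by
    obtain ⟨h1, h2⟩ := h
    cases h2 with
    | adjacent => exact w.compat_adjacent i h1
    | nested h2 => exact w.compat_chain i j h1 h2
  unfold Rel
  rcases hh : M.prec (w.sym i) (w.sym j) with _ | r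
  · exact absurd hh this
  · cases r <;> simp

/-- The structural facts on chains which make summary and hierarchical paths well behaved. -/
structure ChainLaws (w : OPWord M AP) : Prop where
  /-- A position yields precedence to every linked position but the last one. -/
  rel_lt : ∀ {i q h}, w.Link i q → w.Chain i h → q < h → w.Rel PR.lt i q
  /-- Chains do not cross. -/
  le_of_chain : ∀ {i p h q}, w.Chain i h → i < p → p < h → w.Link p q → q ≤ h
  /-- All positions inside a chain that are linked with its right context take precedence. -/
  rel_gt : ∀ {i p h}, w.Chain i h → i < p → p < h → w.Link p h → w.Rel PR.gt p h
  left_unique : ∀ {g g' i}, w.Chain g i → w.Rel PR.lt g i → w.Chain g' i → w.Rel PR.lt g' i →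
    g = g'
  right_unique : ∀ {i h h'}, w.Chain i h → w.Rel PR.gt i h → w.Chain i h' → w.Rel PR.gt i h' →
    h = h'

end OPWord

namespace ParserRun

variable {Sg : Type u} {M : OPM Sg} {R : ParserRun M} {AP : Type v} {lab : ℕ → Set AP}

theorem exists_top_of_link {i j : ℕ} (h : (R.toWord lab).Link i j) :
    ∃ x, 1 ≤ x ∧ x ≤ R.len ∧ R.pos x = j ∧ R.top x = R.node i :=
  trace_of_chainPart h.2 h.1

theorem node_injOn {p q : ℕ} (hp : p ≤ R.pos R.len) (hq : q ≤ R.pos R.len)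
    (h : R.node p = R.node q) : p = q := by
  rw [← pos_node hp, h, pos_node hq]

/-- If `g` yields precedence to the right context `i` of its chain, then `i` is pushed right after
a pop. -/
theorem push_of_chain_of_rel_lt {g i : ℕ} (h : (R.toWord lab).Chain g i)
    (hr : (R.toWord lab).Rel PR.lt g i) :
    R.Push (R.node i) ∧ R.Pop (R.node i - 1) ∧ R.ctx (R.node i - 1) = R.node g := by
  obtain ⟨z, hz, hp, rfl, hc⟩ := exists_pop_of_chain h
  have hi : R.pos (R.ctx z) = g := by rw [hc, pos_node (h.lt.le.trans h.1)]
  rw [← hi, rel_pos_iff hp hz.le] at hr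
  change R.Push (z + 1) at hr
  have : R.node (R.pos z) = z + 1 := by
    rw [← pos_succ_of_pop hp, node_pos hz hr.not_pop]
  rw [this]
  exact ⟨hr, hp, hc⟩

/-- If `i` takes precedence over the right context `h` of its chain, then two pops in a row happen
with lookahead `h`, the first of which closes this chain. -/
theorem pop_of_chain_of_rel_gt {i h : ℕ} (hh : (R.toWord lab).Chain i h)
    (hr : (R.toWord lab).Rel PR.gt i h) :
    ∃ z, z + 1 < R.len ∧ R.Pop z ∧ R.Pop (z + 1) ∧ R.pos z = h ∧ R.ctx z = R.node i := by
  obtain ⟨z, hz, hp, rfl, hc⟩ := exists_pop_of_chain hh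
  have hi : R.pos (R.ctx z) = i := by rw [hc, pos_node (hh.lt.le.trans hh.1)]
  rw [← hi, rel_pos_iff hp hz.le] at hr
  change R.Pop (z + 1) at hr
  exact ⟨z, hr.lt_len hz, hp, hr, rfl, hc⟩

theorem chainLaws : (R.toWord lab).ChainLaws where
  rel_lt {i q h} hl hc hlt := by
    obtain ⟨x, hx1, hx, rfl, ht⟩ := exists_top_of_link hl
    obtain ⟨x', hx1', hx', rfl, ht'⟩ := exists_top_of_link hc.link
    have := exists_pop_of_top_eq hx1 (lt_of_pos_lt hlt) hx' (ht.trans ht'.symm)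
    exact (rel_iff_of_top_eq hx1 hx (hl.lt.le.trans hl.1) ht).2 this.1
  le_of_chain {i p h q} hc h1 h2 hl := by
    obtain ⟨y, hy1, hy, rfl, ht⟩ := exists_top_of_link hc.link
    obtain ⟨x, hx1, hx, rfl, ht'⟩ := exists_top_of_link hl
    by_contra hlt
    have hyx := lt_of_pos_lt (Nat.lt_of_not_le hlt)
    have hp : p ≤ R.pos R.len := h2.le.trans hc.1
    have h3 := node_lt_node h1 hp
    have h4 : R.node p < y := lt_of_pos_lt (by rwa [pos_node hp])
    have := (inv hx1 hx).top_le y (by omega) (by omega)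
    omega
  rel_gt {i p h} hc h1 h2 hl := by
    obtain ⟨z, hz, hpz, hpos, hcz⟩ := exists_pop_of_chain hc
    obtain ⟨x, hx1, hx, rfl, ht'⟩ := exists_top_of_link hl
    have hp : p ≤ R.pos R.len := h2.le.trans hc.1
    have h3 := node_lt_node h1 hp
    have hps := pos_succ_of_pop hpz
    have hts := top_succ_of_pop hpz
    have hxz : x ≤ z := by
      by_contra hlt
      rcases (show z + 1 ≤ x by omega).eq_or_lt with rfl | h4
      · omega
      · have := top_lt_top h4 hx (by omega)
        omega
    have : R.Pop x := by
      rcases hxz.eq_or_lt with rfl | h4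
      · exact hpz
      · exact pop_of_pos_eq hpos.symm h4
    exact (rel_iff_of_top_eq hx1 hx hp ht').2 this
  left_unique {g g' i} hc hr hc' hr' := by
    have h1 := (push_of_chain_of_rel_lt hc hr).2.2
    have h2 := (push_of_chain_of_rel_lt hc' hr').2.2
    exact node_injOn (hc.lt.le.trans hc.1) (hc'.lt.le.trans hc'.1) (h1.symm.trans h2)
  right_unique {i h h'} hc hr hc' hr' := by
    obtain ⟨z, hz, hp, hp1, rfl, hcz⟩ := pop_of_chain_of_rel_gt hc hr
    obtain ⟨z', hz', hp', hp1', rfl, hcz'⟩ := pop_of_chain_of_rel_gt hc' hr'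
    have ht := top_succ_of_pop hp
    have ht' := top_succ_of_pop hp'
    rcases Nat.lt_trichotomy z z' with h1 | rfl | h1
    · have := (exists_pop_of_top_eq (R := R) (x := z + 1) (x' := z' + 1) (by omega) (by omega)
        (by omega) (by omega)).1
      exact absurd hp1 this.not_pop
    · rfl
    · have := (exists_pop_of_top_eq (R := R) (x := z' + 1) (x' := z + 1) (by omega) (by omega)
        (by omega) (by omega)).1
      exact absurd hp1' this.not_pop

/-! ### Hierarchical successors -/

/-- The downward hierarchical successor of `i` is the left context of the chain that is popped just
before the last chain with left context `i`. -/
theorem exists_pop_of_hierNext_d {i j : ℕ} (h : (R.toWord lab).HierNext .d i j) :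
    ∃ y, y + 2 < R.len ∧ R.Pop y ∧ R.Pop (y + 1) ∧ R.Pop (y + 2) ∧
      R.ctx (y + 1) = R.node i ∧ R.ctx y = R.node j := by
  obtain ⟨h, hih, hc, hr, ⟨hij, hcj, hrj⟩, hleast⟩ := h
  obtain ⟨z, hz, hp, hp1, hpos, hcz⟩ := pop_of_chain_of_rel_gt hc hr
  obtain ⟨z', hz', hp', hp1', hpos', hcz'⟩ := pop_of_chain_of_rel_gt hcj hrj
  have hjl := hcj.lt.le.trans hcj.1
  have hnode := node_lt_node hij hjl
  have ht := top_succ_of_pop hp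
  have ht' := top_succ_of_pop hp'
  have hs := pos_succ_of_pop hp
  have hs' := pos_succ_of_pop hp'
  have hlt : z' < z := by
    by_contra hge
    rcases (Nat.le_of_not_lt hge).eq_or_lt with rfl | h1
    · omega
    · have := top_lt_top (R := R) (x := z + 1) (y := z' + 1) (by omega) (by omega) (by omega)
      omega
  obtain ⟨y, rfl⟩ : ∃ y, z = y + 1 := ⟨z - 1, by omega⟩
  have hposy : R.pos y = h := by
    have h1 := pos_mono (R := R) (show z' ≤ y by omega)
    have h2 := pos_mono (R := R) (show y ≤ y + 1 by omega)
    omega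
  have hpy : R.Pop y := pop_of_pos_eq (hposy.trans hpos.symm) (by omega)
  refine ⟨y, hz, hpy, hp, hp1, hcz, ?_⟩
  have hty := top_succ_of_pop hpy
  have hny := node_pos_ctx hpy (by omega)
  have hgt : R.ctx (y + 1) < R.ctx y := by
    have := top_lt_top (R := R) (x := y + 1) (y := y + 1 + 1) (by omega) (by omega) (by omega)
    omega
  have hcy : (R.toWord lab).Chain (R.pos (R.ctx y)) h := hposy ▸ chain_pos hpy (by omega)
  have hle : j ≤ R.pos (R.ctx y) := by
    refine hleast ⟨?_, hcy, hposy ▸ (rel_pos_iff hpy (by omega)).2 hp⟩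
    rw [← pos_node (hc.lt.le.trans hc.1), ← hcz]
    exact pos_lt_of_not_pop (not_pop_ctx hp (by omega)) hgt
  rw [← hny]
  rcases hle.eq_or_lt with h1 | h1
  · rw [h1]
  · exfalso
    have h2 := node_lt_node h1 (hcy.lt.le.trans hcy.1)
    have h3 : R.top (y + 1) ≤ R.top (z' + 1) := by
      rcases (show z' + 1 ≤ y + 1 by omega).eq_or_lt with h4 | h4
      · rw [h4]
      · exact (top_lt_top h4 (by omega) (by omega)).le
    omega

theorem hierNext_d_of_pop {y : ℕ} (hy : y + 2 ≤ R.len) (hp : R.Pop y) (hp1 : R.Pop (y + 1))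
    (hp2 : R.Pop (y + 2)) :
    (R.toWord lab).HierNext .d (R.pos (R.ctx (y + 1))) (R.pos (R.ctx y)) := by
  have hs := pos_succ_of_pop hp
  have hc := chain_pos (lab := lab) hp (by omega)
  have hc1 := chain_pos (lab := lab) hp1 (by omega)
  have ht := top_succ_of_pop hp
  have ht1 := top_succ_of_pop hp1
  have hs1 := pos_succ_of_pop hp1
  have hlt := top_lt_top (R := R) (x := y + 1) (y := y + 1 + 1) (by omega) hy hs1.symm
  refine ⟨R.pos (y + 1), hc1.lt, hc1, (rel_pos_iff hp1 (by omega)).2 hp2,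
    ⟨?_, hs ▸ hc, hs ▸ (rel_pos_iff hp (by omega)).2 hp1⟩, ?_⟩
  · exact pos_lt_of_not_pop (not_pop_ctx hp1 (by omega)) (by omega)
  · rintro k ⟨hk, hck, hrk⟩
    obtain ⟨z, hz, hpz, hposz, hcz⟩ := exists_pop_of_chain hck
    have hkl := hck.lt.le.trans hck.1
    have h1 := node_lt_node hk hkl
    rw [node_pos_ctx hp1 (by omega)] at h1
    have htz := top_succ_of_pop hpz
    have hsz := pos_succ_of_pop hpz
    have h2 : z + 1 < y + 1 + 1 := by
      by_contra hge
      rcases (Nat.le_of_not_lt hge).eq_or_lt with h3 | h3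
      · rw [← h3] at htz; omega
      · have := top_lt_top (R := R) h3 (by omega) (by omega)
        omega
    have h3 : R.top (y + 1) ≤ R.top (z + 1) := by
      rcases (show z + 1 ≤ y + 1 by omega).eq_or_lt with h4 | h4
      · rw [h4]
      · exact (top_lt_top h4 (by omega) (by omega)).le
    rw [← pos_node hkl]
    exact pos_mono (by omega)

/-- The upward hierarchical successor of `i` is the lookahead with which the block pushed in `i` is
popped, provided that it is pushed next. -/
theorem exists_pop_of_hierNext_u {i j : ℕ} (h : (R.toWord lab).HierNext .u i j) :
    ∃ z, z < R.len ∧ R.Pop z ∧ R.Push (z + 1) ∧ R.Pop (R.stack z - 1) ∧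
      R.Push (R.stack z) ∧ R.stack z = R.node i ∧ R.pos z = j := by
  obtain ⟨g, hgi, hc, hr, ⟨hij, hcj, hrj⟩, hleast⟩ := h
  obtain ⟨hpush, hpop, hctx⟩ := push_of_chain_of_rel_lt hc hr
  obtain ⟨hpush', hpop', hctx'⟩ := push_of_chain_of_rel_lt hcj hrj
  have hn1 := hpush.pos
  have hn1' := hpush'.pos
  have hnj := node_le (R := R) j
  have ht : R.top (R.node i) = R.node g := by rw [← hctx]; simp [top, hpop]
  have ht' : R.top (R.node j) = R.node g := by rw [← hctx']; simp [top, hpop']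
  have hlt := node_lt_node hij hcj.1
  obtain ⟨-, z, hz1, hz2, hpz, hsz⟩ := exists_pop_of_top_eq hn1 hlt hnj (ht.trans ht'.symm)
  have hIz := hpz.inv (by omega)
  have hcz : R.ctx z = R.node g := by
    rw [← hIz.top_stack (by omega), hsz, ht]
  have htz := top_succ_of_pop hpz
  have hpushz : R.Push (z + 1) := by
    rcases (show z + 1 ≤ R.node j by omega).eq_or_lt with h1 | h1
    · rw [h1]; exact hpush'
    · exact (exists_pop_of_top_eq (R := R) (x := z + 1) (by omega) h1 hnj (by omega)).1
  have hposz : R.pos z < R.pos (R.node j) ∨ R.pos z = R.pos (R.node j) :=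
    (pos_mono hz2.le).lt_or_eq
  have hg : R.pos (R.ctx z) = g := by rw [hcz, pos_node (hc.lt.le.trans hc.1)]
  refine ⟨z, by omega, hpz, hpushz, by rwa [hsz], by rwa [hsz], hsz, ?_⟩
  have hle : j ≤ R.pos z := by
    refine hleast ⟨?_, hg ▸ chain_pos hpz (by omega), hg ▸ (rel_pos_iff hpz (by omega)).2 hpushz⟩
    rw [← pos_node hc.1]
    exact pos_lt_of_not_pop hpush.not_pop hz1
  rw [pos_node hcj.1] at hposz
  omega

theorem hierNext_u_of_pop {z : ℕ} (hz : z ≤ R.len) (hp : R.Pop z) (hpush : R.Push (z + 1))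
    (hps : R.Pop (R.stack z - 1)) :
    (R.toWord lab).HierNext .u (R.pos (R.stack z)) (R.pos z) := by
  have hI := hp.inv hz
  have h0 := hp.stack_ne_zero hz
  have hlt := hI.stack_lt
  have hpu := hI.push_stack h0
  have hts := hI.top_stack h0
  have hcs : R.ctx (R.stack z - 1) = R.ctx z := by
    rw [← hts]; simp [top, hps]
  have hs1 : R.stack z - 1 + 1 = R.stack z := by omega
  have hss := pos_succ_of_pop hps
  rw [hs1] at hss
  have hc0 := chain_pos (lab := lab) hps (by omega)
  have hr0 := (rel_pos_iff (lab := lab) (r := PR.lt) hps (by omega)).2 (by rw [hs1]; exact hpu)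
  rw [hcs, ← hss] at hc0 hr0
  refine ⟨R.pos (R.ctx z), hc0.lt, hc0, hr0, ⟨pos_lt_of_not_pop hpu.not_pop hlt, chain_pos hp hz,
    (rel_pos_iff hp hz).2 hpush⟩, ?_⟩
  rintro k ⟨hk, hck, hrk⟩
  obtain ⟨z', hz', hp', rfl, hc'⟩ := exists_pop_of_chain hck
  rw [node_pos_ctx hp hz] at hc'
  have ht' := top_succ_of_pop hp'
  have h1 := lt_of_pos_lt hk
  obtain ⟨-, y, hy1, hy2, hpy, hsy⟩ := exists_pop_of_top_eq (R := R) (x := R.stack z)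
    (x' := z' + 1) (by omega) (by omega) (by omega) (by omega)
  have : y = z := hpy.eq_of_stack_eq hp (by omega) hz hsy
  exact pos_mono (by omega)

end ParserRun

namespace OPWord

variable {Sg : Type u} {M : OPM Sg} {AP : Type v} {w : OPWord M AP}

/-! ### Summary paths -/

theorem isSummaryPath_singleton {t : Dir} {i : ℕ} (hi : i ≤ w.last) : w.IsSummaryPath t i i [i] :=
  ⟨hi, rfl, rfl, List.isChain_singleton _⟩

theorem IsSummaryPath.cons {t : Dir} {i b j : ℕ} {l : List ℕ} (hs : w.SummaryStep t j i b)
    (h : w.IsSummaryPath t b j l) : w.IsSummaryPath t i j (i :: l) := by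
  obtain ⟨h1, h2, h3, h4⟩ := h
  cases l with
  | nil => simp at h2
  | cons c l =>
    obtain rfl : c = b := by simpa using h2
    exact ⟨h1, rfl, by simpa using h3, h4.cons_cons hs⟩

theorem IsSummaryPath.eq_or_step {t : Dir} {i j : ℕ} {l : List ℕ} (h : w.IsSummaryPath t i j l) :
    (l = [i] ∧ j = i) ∨
      ∃ b l', l = i :: l' ∧ w.SummaryStep t j i b ∧ w.IsSummaryPath t b j l' := by
  obtain ⟨h1, h2, h3, h4⟩ := h
  match l with
  | [] => simp at h2
  | [c] =>
    obtain rfl : c = i := by simpa using h2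
    exact Or.inl ⟨rfl, by simpa using h3.symm⟩
  | c :: b :: l =>
    obtain rfl : c = i := by simpa using h2
    rw [List.isChain_cons_cons] at h4
    exact Or.inr ⟨b, b :: l, rfl, h4.1, h1, rfl, by simpa using h3, h4.2⟩

theorem SummaryStep.lt {t : Dir} {j a b : ℕ} (h : w.SummaryStep t j a b) : a < b := by
  rcases h with h | h
  · exact h.1.2.1.lt
  · omega

theorem IsSummaryPath.le_of_mem {t : Dir} {i j m : ℕ} {l : List ℕ} (h : w.IsSummaryPath t i j l)
    (hm : m ∈ l) : i ≤ m := by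
  induction l generalizing i with
  | nil => simp at hm
  | cons c l ih =>
    rcases h.eq_or_step with ⟨h1, rfl⟩ | ⟨b, l', h1, h2, h3⟩
    · rw [h1] at hm
      simp at hm
      omega
    · obtain ⟨rfl, rfl⟩ := List.cons.inj h1
      have := h2.lt
      rcases List.mem_cons.1 hm with rfl | hm
      · exact le_rfl
      · have := ih h3 hm
        omega

theorem IsSummaryPath.le {t : Dir} {i j : ℕ} {l : List ℕ} (h : w.IsSummaryPath t i j l) : i ≤ j :=
  h.le_of_mem (List.mem_of_getLast? h.2.2.1)

theorem SummaryStep.dirRel {t : Dir} {j a b : ℕ} (h : w.SummaryStep t j a b) : w.DirRel t a b := by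
  rcases h with h | ⟨-, rfl, h⟩
  · exact h.1.2.2
  · exact h

theorem SummaryStep.link {t : Dir} {j a b : ℕ} (h : w.SummaryStep t j a b) (hb : b ≤ w.last) :
    w.Link a b := by
  rcases h with h | ⟨-, rfl, -⟩
  · exact h.1.2.1.link
  · exact link_succ hb

theorem DirRel.not_gt {i j : ℕ} (h : w.DirRel .d i j) : ¬ w.Rel PR.gt i j := by
  rintro h'
  rcases h with h | h <;> cases h.unique h'

theorem DirRel.not_lt {i j : ℕ} (h : w.DirRel .u i j) : ¬ w.Rel PR.lt i j := by
  rintro h'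
  rcases h with h | h <;> cases h.unique h'

/-- A downward summary path that starts inside a chain stays inside it. -/
theorem ChainLaws.lt_of_isSummaryPath_d (hL : w.ChainLaws) {i p h j : ℕ} {l : List ℕ}
    (hc : w.Chain i h) (hip : i < p) (hph : p < h) (hl : w.IsSummaryPath .d p j l) : j < h := by
  induction l generalizing p with
  | nil => cases hl.2.1
  | cons c l ih =>
    rcases hl.eq_or_step with ⟨-, rfl⟩ | ⟨b, l', h1, h2, h3⟩
    · exact hph
    · obtain ⟨rfl, rfl⟩ := List.cons.inj h1
      have hlt := h2.lt
      have hlink := h2.link (h3.le.trans h3.1)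
      refine ih (by omega) (lt_of_le_of_ne (hL.le_of_chain hc hip hph hlink) ?_) h3
      rintro rfl
      exact h2.dirRel.not_gt (hL.rel_gt hc hip hph hlink)

/-- A linked position in direction `t` from which a summary path leads to `j` is the first step of a
summary path to `j`: no longer chain is available. -/
theorem ChainLaws.not_chain_of_link (hL : w.ChainLaws) {t : Dir} {i q h j : ℕ} {l : List ℕ}
    (hq : w.Link i q) (hr : w.DirRel t i q) (hl : w.IsSummaryPath t q j l) (hc : w.Chain i h)
    (hqh : q < h) : ¬ h ≤ j := by
  cases t with
  | d =>
    have := hL.lt_of_isSummaryPath_d hc hq.lt hqh hl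
    omega
  | u => exact absurd (hL.rel_lt hq hc hqh) hr.not_lt

theorem ChainLaws.summaryStep_succ (hL : w.ChainLaws) {t : Dir} {i j : ℕ} {l : List ℕ}
    (hr : w.DirRel t i (i + 1)) (hl : w.IsSummaryPath t (i + 1) j l) :
    w.SummaryStep t j i (i + 1) := by
  refine Or.inr ⟨?_, rfl, hr⟩
  rintro ⟨h, hj, hc, -⟩
  exact hL.not_chain_of_link (link_succ (hl.le.trans hl.1)) hr hl hc hc.2.succ_lt hj

theorem ChainLaws.summaryStep_chain (hL : w.ChainLaws) {t : Dir} {i q j : ℕ} {l : List ℕ}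
    (hc : w.Chain i q) (hr : w.DirRel t i q) (hl : w.IsSummaryPath t q j l) :
    w.SummaryStep t j i q := by
  refine Or.inl ⟨⟨hl.le, hc, hr⟩, ?_⟩
  rintro h ⟨hj, hc', -⟩
  by_contra hlt
  exact hL.not_chain_of_link hc.link hr hl hc' (by omega) hj

/-! ### Hierarchical paths -/

/-- The hierarchical positions: right contexts of a chain whose left context yields precedence
(upward), left contexts of a chain over whose right context they take precedence (downward). -/
def IsHier (w : OPWord M AP) (t : Dir) (i : ℕ) : Prop :=
  match t with
  | .d => ∃ h, w.Chain i h ∧ w.Rel PR.gt i h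
  | .u => ∃ h, w.Chain h i ∧ w.Rel PR.lt h i

theorem isHierPath_singleton {t : Dir} {i : ℕ} (hi : w.IsHier t i) : w.IsHierPath t i i [i] := by
  refine ⟨rfl, rfl, ?_⟩
  cases t with
  | d =>
    obtain ⟨h, hc, hr⟩ := hi
    exact ⟨h, hc.lt, by simpa using ⟨hc, hr⟩, List.isChain_singleton _⟩
  | u =>
    obtain ⟨h, hc, hr⟩ := hi
    exact ⟨h, hc.lt, by simpa using ⟨hc, hr⟩, List.isChain_singleton _⟩

theorem HierNext.lt {t : Dir} {i j : ℕ} (h : w.HierNext t i j) : i < j := by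
  cases t with
  | d =>
    obtain ⟨_, _, _, _, h, _⟩ := h
    exact h.1
  | u =>
    obtain ⟨_, _, _, _, h, _⟩ := h
    exact h.1

theorem HierNext.le_last {t : Dir} {i j : ℕ} (h : w.HierNext t i j) : j ≤ w.last := by
  cases t with
  | d =>
    obtain ⟨_, _, _, _, ⟨_, h, _⟩, _⟩ := h
    exact h.lt.le.trans h.1
  | u =>
    obtain ⟨_, _, _, _, ⟨_, h, _⟩, _⟩ := h
    exact h.1

/-- Consecutive elements of a hierarchical path are hierarchical successors; the context `h` shared
by the path is determined by each of its elements. -/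
theorem ChainLaws.isHierPath_cons (hL : w.ChainLaws) {t : Dir} {i b j : ℕ} {l : List ℕ}
    (hn : w.HierNext t i b) (hl : w.IsHierPath t b j l) : w.IsHierPath t i j (i :: l) := by
  obtain ⟨h1, h2, h3⟩ := hl
  match l, h1 with
  | c :: l, h1 =>
    obtain rfl : c = b := by simpa using h1
    refine ⟨rfl, by simpa using h2, ?_⟩
    cases t with
    | d =>
      obtain ⟨h, hj, hall, hch⟩ := h3
      obtain ⟨h', hlt, hc, hr, ⟨hic, hcc, hrc⟩, hmin⟩ := hn
      obtain ⟨hcc', hrc'⟩ := hall c (by simp)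
      obtain rfl := hL.right_unique hcc hrc hcc' hrc'
      refine ⟨h', hj, ?_, hch.cons_cons ⟨hic, ?_⟩⟩
      · intro p hp
        rcases List.mem_cons.1 hp with rfl | hp
        · exact ⟨hc, hr⟩
        · exact hall p hp
      · rintro ⟨k, hk1, hk2, hk3⟩
        have := hmin ⟨hk1, hk3, hL.rel_gt hc hk1 hk3.lt hk3.link⟩
        omega
    | u =>
      obtain ⟨h, hj, hall, hch⟩ := h3
      obtain ⟨h', hlt, hc, hr, ⟨hic, hcc, hrc⟩, hmin⟩ := hn
      obtain ⟨hcc', hrc'⟩ := hall c (by simp)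
      obtain rfl := hL.left_unique hcc hrc hcc' hrc'
      refine ⟨h', hj, ?_, hch.cons_cons ⟨hic, ?_⟩⟩
      · intro p hp
        rcases List.mem_cons.1 hp with rfl | hp
        · exact ⟨hc, hr⟩
        · exact hall p hp
      · rintro ⟨k, hk1, hk2, hk3⟩
        have := hmin ⟨hk1, hk3, hL.rel_lt hk3.link hcc hk2⟩
        omega

theorem IsHierPath.isHier {t : Dir} {i j : ℕ} {l : List ℕ} (hl : w.IsHierPath t i j l) :
    w.IsHier t i := by
  obtain ⟨h1, h2, h3⟩ := hl
  have hi := List.mem_of_head? h1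
  cases t with
  | d =>
    obtain ⟨h, _, hall, _⟩ := h3
    exact ⟨h, hall i hi⟩
  | u =>
    obtain ⟨h, _, hall, _⟩ := h3
    exact ⟨h, hall i hi⟩

theorem IsHierPath.eq_or_next {t : Dir} {i j : ℕ} {l : List ℕ} (hl : w.IsHierPath t i j l) :
    (l = [i] ∧ j = i) ∨ ∃ b l', l = i :: l' ∧ w.HierNext t i b ∧ w.IsHierPath t b j l' := by
  obtain ⟨h1, h2, h3⟩ := hl
  match l with
  | [] => simp at h1
  | [c] =>
    obtain rfl : c = i := by simpa using h1
    exact Or.inl ⟨rfl, by simpa using h2.symm⟩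
  | c :: b :: l =>
    obtain rfl : c = i := by simpa using h1
    refine Or.inr ⟨b, b :: l, rfl, ?_⟩
    cases t with
    | d =>
      obtain ⟨h, hj, hall, hch⟩ := h3
      rw [List.isChain_cons_cons] at hch
      have hc := hall c (by simp)
      have hb := hall b (by simp)
      refine ⟨⟨h, hc.1.lt, hc.1, hc.2, ⟨hch.1.1, hb⟩, ?_⟩, rfl, by simpa using h2, h, hj,
        fun p hp => hall p (List.mem_cons_of_mem _ hp), hch.2⟩
      rintro k ⟨hk1, hk2, -⟩
      by_contra hlt
      exact hch.1.2 ⟨k, hk1, by omega, hk2⟩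
    | u =>
      obtain ⟨h, hj, hall, hch⟩ := h3
      rw [List.isChain_cons_cons] at hch
      have hc := hall c (by simp)
      have hb := hall b (by simp)
      refine ⟨⟨h, hc.1.lt, hc.1, hc.2, ⟨hch.1.1, hb⟩, ?_⟩, rfl, by simpa using h2, h, hj,
        fun p hp => hall p (List.mem_cons_of_mem _ hp), hch.2⟩
      rintro k ⟨hk1, hk2, -⟩
      by_contra hlt
      exact hch.1.2 ⟨k, hk1, by omega, hk2⟩

theorem IsHierPath.le_of_mem {t : Dir} {i j m : ℕ} {l : List ℕ} (h : w.IsHierPath t i j l)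
    (hm : m ∈ l) : i ≤ m := by
  induction l generalizing i with
  | nil => simp at hm
  | cons c l ih =>
    rcases h.eq_or_next with ⟨h1, rfl⟩ | ⟨b, l', h1, h2, h3⟩
    · rw [h1] at hm
      simp at hm
      omega
    · obtain ⟨rfl, rfl⟩ := List.cons.inj h1
      have := h2.lt
      rcases List.mem_cons.1 hm with rfl | hm
      · exact le_rfl
      · have := ih h3 hm
        omega

theorem IsHierPath.le {t : Dir} {i j : ℕ} {l : List ℕ} (h : w.IsHierPath t i j l) : i ≤ j :=
  h.le_of_mem (List.mem_of_getLast? h.2.1)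

end OPWord

/-! ### Negation normal forms -/

/-- Negation occurs only in front of structural symbols and atomic propositions. -/
def Formula.IsNNF {Sg : Type u} {AP : Type v} : Formula Sg AP → Prop
  | .str _ => True
  | .prop _ => True
  | .neg (.str _) => True
  | .neg (.prop _) => True
  | .neg _ => False
  | .and α β => α.IsNNF ∧ β.IsNNF
  | .or α β => α.IsNNF ∧ β.IsNNF
  | .next _ α => α.IsNNF
  | .wnext _ α => α.IsNNF
  | .cnext _ α => α.IsNNF
  | .wcnext _ α => α.IsNNF
  | .cuntil _ α β => α.IsNNF ∧ β.IsNNF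
  | .crelease _ α β => α.IsNNF ∧ β.IsNNF
  | .hnext _ α => α.IsNNF
  | .whnext _ α => α.IsNNF
  | .huntil _ α β => α.IsNNF ∧ β.IsNNF
  | .hrelease _ α β => α.IsNNF ∧ β.IsNNF

theorem isNNF_nnfAux {Sg : Type u} {AP : Type v} (φ : Formula Sg AP) (b : Bool) :
    (nnfAux b φ).IsNNF := by
  induction φ generalizing b <;> cases b <;> simp_all [nnfAux, Formula.IsNNF]

namespace OPWord

variable {Sg : Type u} {M : OPM Sg} {AP : Type v} {w : OPWord M AP}

theorem IsSummaryPath.mem_le {t : Dir} {i j m : ℕ} {l : List ℕ} (h : w.IsSummaryPath t i j l)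
    (hm : m ∈ l) : m ≤ j := by
  induction l generalizing i with
  | nil => simp at hm
  | cons c l ih =>
    rcases h.eq_or_step with ⟨h1, rfl⟩ | ⟨b, l', h1, h2, h3⟩
    · rw [h1] at hm
      simp at hm
      omega
    · obtain ⟨rfl, rfl⟩ := List.cons.inj h1
      rcases List.mem_cons.1 hm with rfl | hm
      · exact h.le
      · exact ih h3 hm

theorem IsHierPath.mem_le {t : Dir} {i j m : ℕ} {l : List ℕ} (h : w.IsHierPath t i j l)
    (hm : m ∈ l) : m ≤ j := by
  induction l generalizing i with
  | nil => simp at hm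
  | cons c l ih =>
    rcases h.eq_or_next with ⟨h1, rfl⟩ | ⟨b, l', h1, h2, h3⟩
    · rw [h1] at hm
      simp at hm
      omega
    · obtain ⟨rfl, rfl⟩ := List.cons.inj h1
      rcases List.mem_cons.1 hm with rfl | hm
      · exact h.le
      · exact ih h3 hm

/-- Summary steps depend on the end of the path, but remain steps when the path is cut. -/
theorem SummaryStep.cut {t : Dir} {j m a b : ℕ} (h : w.SummaryStep t j a b) (hb : b ≤ m)
    (hm : m ≤ j) : w.SummaryStep t m a b := by
  rcases h with ⟨h1, h2⟩ | ⟨h1, h2⟩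
  · exact Or.inl ⟨⟨hb, h1.2⟩, fun c hc => h2 ⟨hc.1.trans hm, hc.2⟩⟩
  · exact Or.inr ⟨fun ⟨c, hc⟩ => h1 ⟨c, hc.1.trans hm, hc.2⟩, h2⟩

theorem IsSummaryPath.exists_prefix {t : Dir} {i j m : ℕ} {l : List ℕ}
    (h : w.IsSummaryPath t i j l) (hm : m ∈ l) : ∃ l', w.IsSummaryPath t i m l' ∧ l' ⊆ l := by
  induction l generalizing i with
  | nil => simp at hm
  | cons c l ih =>
    have hle := h.le
    have hj := h.1
    have hmj := h.mem_le hm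
    rcases h.eq_or_step with ⟨h1, rfl⟩ | ⟨b, l', h1, h2, h3⟩
    · obtain rfl : m = j := by simpa [h1] using hm
      exact ⟨_, h, fun _ h => h⟩
    · obtain ⟨rfl, rfl⟩ := List.cons.inj h1
      rcases List.mem_cons.1 hm with rfl | hm
      · exact ⟨[m], isSummaryPath_singleton (hle.trans hj), by simp⟩
      · obtain ⟨l'', h4, h5⟩ := ih h3 hm
        exact ⟨c :: l'', h4.cons (h2.cut h4.le hmj), List.cons_subset_cons _ h5⟩

theorem ChainLaws.exists_prefix (hL : w.ChainLaws) {t : Dir} {i j m : ℕ} {l : List ℕ}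
    (h : w.IsHierPath t i j l) (hm : m ∈ l) : ∃ l', w.IsHierPath t i m l' ∧ l' ⊆ l := by
  induction l generalizing i with
  | nil => simp at hm
  | cons c l ih =>
    rcases h.eq_or_next with ⟨h1, rfl⟩ | ⟨b, l', h1, h2, h3⟩
    · obtain rfl : m = j := by simpa [h1] using hm
      exact ⟨_, h, fun _ h => h⟩
    · obtain ⟨rfl, rfl⟩ := List.cons.inj h1
      rcases List.mem_cons.1 hm with rfl | hm
      · exact ⟨[m], isHierPath_singleton h.isHier, by simp⟩
      · obtain ⟨l'', h4, h5⟩ := ih h3 hm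
        exact ⟨c :: l'', hL.isHierPath_cons h2 h4, List.cons_subset_cons _ h5⟩

/-- Until and release are dual over any family of paths `P j l` (`l` ends in `j`) that is closed
under cutting a path in one of its elements. -/
theorem not_until_iff {P : ℕ → List ℕ → Prop} {i : ℕ} {A B : ℕ → Prop}
    (hmem : ∀ j l, P j l → j ∈ l ∧ ∀ m ∈ l, i ≤ m ∧ m ≤ j)
    (hpre : ∀ j l, P j l → ∀ m ∈ l, ∃ l', P m l' ∧ l' ⊆ l) :
    (¬ ∃ j l, i ≤ j ∧ P j l ∧ B j ∧ ∀ m ∈ l, m < j → A m) ↔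
      ∀ j l, i ≤ j → P j l →
        (∀ m ∈ l, ¬ B m) ∨ ∃ k ∈ l, ¬ A k ∧ ∀ m ∈ l, m ≤ k → ¬ B m := by
  classical
  constructor
  · intro hU j l _ hl
    by_cases hB : ∃ m, m ∈ l ∧ B m
    · right
      -- cut the path in its first element that satisfies `B`
      have hm := Nat.find_spec hB
      obtain ⟨l', hl', hsub⟩ := hpre j l hl _ hm.1
      by_contra hk
      refine hU ⟨Nat.find hB, l', ((hmem j l hl).2 _ hm.1).1, hl', hm.2, fun k hk' hlt => ?_⟩
      by_contra hA
      refine hk ⟨k, hsub hk', hA, fun m hml hmk hBm => ?_⟩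
      exact Nat.find_min hB (hmk.trans_lt hlt) ⟨hml, hBm⟩
    · exact Or.inl fun m hm hBm => hB ⟨m, hm, hBm⟩
  · rintro hR ⟨j, l, hij, hl, hB, hA⟩
    obtain ⟨hjl, hle⟩ := hmem j l hl
    rcases hR j l hij hl with h | ⟨k, hk, hAk, hBk⟩
    · exact h j hjl hB
    · rcases (hle k hk).2.lt_or_eq with h | rfl
      · exact hAk (hA k hk h)
      · exact hBk k hk le_rfl hB

theorem sat_crelease_iff {t : Dir} {α β α' β' : Formula Sg AP} {i : ℕ}
    (hα : ∀ i, w.Sat i α' ↔ ¬ w.Sat i α) (hβ : ∀ i, w.Sat i β' ↔ ¬ w.Sat i β) :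
    w.Sat i (.crelease t α' β') ↔ ¬ w.Sat i (.cuntil t α β) := by
  simp only [Sat, hα, hβ]
  exact (not_until_iff (fun j l h => ⟨List.mem_of_getLast? h.2.2.1,
    fun m hm => ⟨h.le_of_mem hm, h.mem_le hm⟩⟩) fun j l h m hm => h.exists_prefix hm).symm

theorem ChainLaws.sat_hrelease_iff (hL : w.ChainLaws) {t : Dir} {α β α' β' : Formula Sg AP} {i : ℕ}
    (hα : ∀ i, w.Sat i α' ↔ ¬ w.Sat i α) (hβ : ∀ i, w.Sat i β' ↔ ¬ w.Sat i β) :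
    w.Sat i (.hrelease t α' β') ↔ ¬ w.Sat i (.huntil t α β) := by
  simp only [Sat, hα, hβ]
  exact (not_until_iff (fun j l h => ⟨List.mem_of_getLast? h.2.1,
    fun m hm => ⟨h.le_of_mem hm, h.mem_le hm⟩⟩) fun j l h m hm => hL.exists_prefix h hm).symm

theorem ChainLaws.sat_nnfAux (hL : w.ChainLaws) (φ : Formula Sg AP) :
    (∀ i, w.Sat i (nnfAux true φ) ↔ w.Sat i φ) ∧
      ∀ i, w.Sat i (nnfAux false φ) ↔ ¬ w.Sat i φ := by
  induction φ with
  | str a => simp [nnfAux, Sat]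
  | prop p => simp [nnfAux, Sat]
  | neg φ ih => simp [nnfAux, Sat, ih]
  | and φ ψ ih1 ih2 => simp [nnfAux, Sat, ih1, ih2, imp_iff_not_or]
  | or φ ψ ih1 ih2 => simp [nnfAux, Sat, ih1, ih2]
  | next t φ ih => simp [nnfAux, Sat, ih]
  | wnext t φ ih => simp [nnfAux, Sat, ih]
  | cnext t φ ih => simp [nnfAux, Sat, ih]
  | wcnext t φ ih => simp [nnfAux, Sat, ih]
  | hnext t φ ih => simp [nnfAux, Sat, ih]
  | whnext t φ ih => simp [nnfAux, Sat, ih]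
  | cuntil t φ ψ ih1 ih2 =>
    exact ⟨fun i => by simp only [nnfAux, Sat, ih1, ih2],
      fun i => sat_crelease_iff ih1.2 ih2.2⟩
  | crelease t φ ψ ih1 ih2 =>
    refine ⟨fun i => by simp only [nnfAux, Sat, ih1, ih2], fun i => ?_⟩
    rw [sat_crelease_iff (α := nnfAux false φ) (β := nnfAux false ψ), not_not]
    · rfl
    · simp [ih1]
    · simp [ih2]
  | huntil t φ ψ ih1 ih2 =>
    exact ⟨fun i => by simp only [nnfAux, Sat, ih1, ih2],
      fun i => hL.sat_hrelease_iff ih1.2 ih2.2⟩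
  | hrelease t φ ψ ih1 ih2 =>
    refine ⟨fun i => by simp only [nnfAux, Sat, ih1, ih2], fun i => ?_⟩
    rw [hL.sat_hrelease_iff (α := nnfAux false φ) (β := nnfAux false ψ), not_not]
    · rfl
    · simp [ih1]
    · simp [ih2]

/-! ### Locally consistent labellings -/

/-- `H p ψ` labels the positions `p ≥ 1` of the word with members of the closure of `φ`,
consistently with the local semantics: Boolean connectives and next formulas are obeyed, until and
release formulas are unfolded by one step. -/
structure LocallyConsistent (w : OPWord M AP) (φ : Formula Sg AP)
    (H : ℕ → Formula Sg AP → Prop) : Prop where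
  str : ∀ {p a}, 1 ≤ p → p ≤ w.last → (H p (.str a) ↔ w.sym p = some a)
  prop : ∀ {p a}, 1 ≤ p → p ≤ w.last → (H p (.prop a) ↔ a ∈ w.lab p)
  neg : ∀ {p α}, H p (.neg α) → ¬ H p α
  and : ∀ {p α β}, H p (.and α β) → H p α ∧ H p β
  or : ∀ {p α β}, H p (.or α β) → H p α ∨ H p β
  next : ∀ {p t α}, 1 ≤ p → p ≤ w.last → Closure φ (.next t α) → H p (.next t α) →
    p < w.last ∧ w.DirRel t p (p + 1) ∧ H (p + 1) α
  wnext : ∀ {p t α}, 1 ≤ p → p < w.last → Closure φ (.wnext t α) → H p (.wnext t α) →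
    w.DirRel t p (p + 1) → H (p + 1) α
  cnext : ∀ {p t α}, 1 ≤ p → p ≤ w.last → Closure φ (.cnext t α) → H p (.cnext t α) →
    ∃ q, w.Chain p q ∧ w.DirRel t p q ∧ H q α
  wcnext : ∀ {p q t α}, 1 ≤ p → Closure φ (.wcnext t α) → H p (.wcnext t α) →
    w.Chain p q → w.DirRel t p q → H q α
  hnext : ∀ {p t α}, 1 ≤ p → p ≤ w.last → Closure φ (.hnext t α) → H p (.hnext t α) →
    ∃ q, w.HierNext t p q ∧ H q α
  whnext : ∀ {p q t α}, 1 ≤ p → Closure φ (.whnext t α) → H p (.whnext t α) →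
    w.HierNext t p q → H q α
  cuntil : ∀ {p t α β}, H p (.cuntil t α β) →
    H p β ∨ (H p α ∧ (H p (.next t (.cuntil t α β)) ∨ H p (.cnext t (.cuntil t α β))))
  crelease : ∀ {p t α β}, H p (.crelease t α β) →
    H p β ∧ (H p α ∨ (H p (.wnext t (.crelease t α β)) ∧ H p (.wcnext t (.crelease t α β))))
  huntil : ∀ {p t α β}, 1 ≤ p → p ≤ w.last → H p (.huntil t α β) →
    (H p β ∧ w.IsHier t p) ∨ (H p α ∧ H p (.hnext t (.huntil t α β)))
  hrelease : ∀ {p t α β}, 1 ≤ p → p ≤ w.last → H p (.hrelease t α β) →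
    (w.IsHier t p → H p β) ∧ (H p α ∨ H p (.whnext t (.hrelease t α β)))

namespace LocallyConsistent

variable {φ : Formula Sg AP} {H : ℕ → Formula Sg AP → Prop}

theorem sat_cuntil (hL : w.ChainLaws) (hH : w.LocallyConsistent φ H) {t : Dir}
    {α β : Formula Sg AP} (hC : Closure φ (.cuntil t α β))
    (hα : ∀ p, 1 ≤ p → p ≤ w.last → H p α → w.Sat p α)
    (hβ : ∀ p, 1 ≤ p → p ≤ w.last → H p β → w.Sat p β) (p : ℕ) (h1 : 1 ≤ p) (hp : p ≤ w.last)
    (h : H p (.cuntil t α β)) : w.Sat p (.cuntil t α β) := by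
  have key : ∀ q l j, (p < q ∧ w.IsSummaryPath t q j l ∧ w.SummaryStep t j p q ∧ w.Sat j β ∧
      ∀ m ∈ l, m < j → w.Sat m α) → w.Sat p α → w.Sat p (.cuntil t α β) := by
    rintro q l j ⟨hpq, hl, hs, hj, hm⟩ hpα
    refine ⟨j, p :: l, hpq.le.trans hl.le, hl.cons hs, hj, ?_⟩
    intro m hml hmj
    rcases List.mem_cons.1 hml with rfl | hml
    · exact hpα
    · exact hm m hml hmj
  rcases hH.cuntil h with h | ⟨h2, h | h⟩
  · exact ⟨p, [p], le_rfl, isSummaryPath_singleton hp, hβ p h1 hp h, by simp⟩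
  · obtain ⟨hlt, hr, hU⟩ := hH.next h1 hp hC.cuntil_next h
    obtain ⟨j, l, hle, hl, hj, hm⟩ :=
      sat_cuntil hL hH hC hα hβ (p + 1) (by omega) hlt hU
    exact key _ l j ⟨by omega, hl, hL.summaryStep_succ hr hl, hj, hm⟩ (hα p h1 hp h2)
  · obtain ⟨q, hc, hr, hU⟩ := hH.cnext h1 hp hC.cuntil_cnext h
    have hpq := hc.lt
    have hql := hc.1
    obtain ⟨j, l, hle, hl, hj, hm⟩ := sat_cuntil hL hH hC hα hβ q (by omega) hc.1 hU
    exact key _ l j ⟨hc.lt, hl, hL.summaryStep_chain hc hr hl, hj, hm⟩ (hα p h1 hp h2)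
termination_by w.last - p

theorem sat_crelease (hH : w.LocallyConsistent φ H) {t : Dir}
    {α β : Formula Sg AP} (hC : Closure φ (.crelease t α β))
    (hα : ∀ p, 1 ≤ p → p ≤ w.last → H p α → w.Sat p α)
    (hβ : ∀ p, 1 ≤ p → p ≤ w.last → H p β → w.Sat p β) (p : ℕ) (h1 : 1 ≤ p) (hp : p ≤ w.last)
    (h : H p (.crelease t α β)) : w.Sat p (.crelease t α β) := by
  intro j l _ hl
  obtain ⟨hb, hor⟩ := hH.crelease h
  have hpβ := hβ p h1 hp hb
  rcases hor with ha | ⟨hn, hcn⟩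
  · refine Or.inr ⟨p, List.mem_of_head? hl.2.1, hα p h1 hp ha, fun m hm hmp => ?_⟩
    obtain rfl : m = p := le_antisymm hmp (hl.le_of_mem hm)
    exact hpβ
  · rcases hl.eq_or_step with ⟨rfl, rfl⟩ | ⟨b, l', rfl, hs, hl'⟩
    · exact Or.inl (by simpa using hpβ)
    · have hbl := hl'.le.trans hl'.1
      have hlt := hs.lt
      have hR : H b (.crelease t α β) := by
        rcases hs with ⟨⟨-, hc, hr⟩, -⟩ | ⟨-, rfl, hr⟩
        · exact hH.wcnext h1 hC.crelease_wcnext hcn hc hr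
        · exact hH.wnext h1 hbl hC.crelease_wnext hn hr
      rcases sat_crelease hH hC hα hβ b (by omega) hbl hR j l' hl'.le hl' with
        hall | ⟨k, hk, hka, hkb⟩
      · left
        intro m hm
        rcases List.mem_cons.1 hm with rfl | hm
        · exact hpβ
        · exact hall m hm
      · refine Or.inr ⟨k, List.mem_cons_of_mem _ hk, hka, fun m hm hmk => ?_⟩
        rcases List.mem_cons.1 hm with rfl | hm
        · exact hpβ
        · exact hkb m hm hmk
termination_by w.last - p

theorem sat_huntil (hL : w.ChainLaws) (hH : w.LocallyConsistent φ H) {t : Dir}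
    {α β : Formula Sg AP} (hC : Closure φ (.huntil t α β))
    (hα : ∀ p, 1 ≤ p → p ≤ w.last → H p α → w.Sat p α)
    (hβ : ∀ p, 1 ≤ p → p ≤ w.last → H p β → w.Sat p β) (p : ℕ) (h1 : 1 ≤ p) (hp : p ≤ w.last)
    (h : H p (.huntil t α β)) : w.Sat p (.huntil t α β) := by
  rcases hH.huntil h1 hp h with ⟨hb, hz⟩ | ⟨ha, hn⟩
  · exact ⟨p, [p], le_rfl, isHierPath_singleton hz, hβ p h1 hp hb, by simp⟩
  · obtain ⟨q, hq, hU⟩ := hH.hnext h1 hp hC.huntil_hnext hn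
    have hpq := hq.lt
    have hql := hq.le_last
    obtain ⟨j, l, hle, hl, hj, hm⟩ := sat_huntil hL hH hC hα hβ q (by omega) hq.le_last hU
    refine ⟨j, p :: l, by omega, hL.isHierPath_cons hq hl, hj, ?_⟩
    intro m hml hmj
    rcases List.mem_cons.1 hml with rfl | hml
    · exact hα m h1 hp ha
    · exact hm m hml hmj
termination_by w.last - p

theorem sat_hrelease (hH : w.LocallyConsistent φ H) {t : Dir}
    {α β : Formula Sg AP} (hC : Closure φ (.hrelease t α β))
    (hα : ∀ p, 1 ≤ p → p ≤ w.last → H p α → w.Sat p α)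
    (hβ : ∀ p, 1 ≤ p → p ≤ w.last → H p β → w.Sat p β) (p : ℕ) (h1 : 1 ≤ p) (hp : p ≤ w.last)
    (h : H p (.hrelease t α β)) : w.Sat p (.hrelease t α β) := by
  intro j l _ hl
  obtain ⟨hb, hor⟩ := hH.hrelease h1 hp h
  have hpβ := hβ p h1 hp (hb hl.isHier)
  rcases hor with ha | hn
  · refine Or.inr ⟨p, List.mem_of_head? hl.1, hα p h1 hp ha, fun m hm hmp => ?_⟩
    obtain rfl : m = p := le_antisymm hmp (hl.le_of_mem hm)
    exact hpβ
  · rcases hl.eq_or_next with ⟨rfl, rfl⟩ | ⟨b, l', rfl, hs, hl'⟩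
    · exact Or.inl (by simpa using hpβ)
    · have hbl := hs.le_last
      have hlt := hs.lt
      have hR : H b (.hrelease t α β) := hH.whnext h1 hC.hrelease_whnext hn hs
      rcases sat_hrelease hH hC hα hβ b (by omega) hbl hR j l' hl'.le hl' with
        hall | ⟨k, hk, hka, hkb⟩
      · left
        intro m hm
        rcases List.mem_cons.1 hm with rfl | hm
        · exact hpβ
        · exact hall m hm
      · refine Or.inr ⟨k, List.mem_cons_of_mem _ hk, hka, fun m hm hmk => ?_⟩
        rcases List.mem_cons.1 hm with rfl | hm
        · exact hpβ
        · exact hkb m hm hmk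
termination_by w.last - p

/-- The truth lemma: a locally consistent labelling is sound. -/
theorem sat (hL : w.ChainLaws) (hH : w.LocallyConsistent φ H) {ψ : Formula Sg AP}
    (hψ : ψ.IsNNF) (hC : Closure φ ψ) (p : ℕ) (h1 : 1 ≤ p) (hp : p ≤ w.last) (h : H p ψ) :
    w.Sat p ψ := by
  induction ψ generalizing p with
  | str a => exact (hH.str h1 hp).1 h
  | prop a => exact (hH.prop h1 hp).1 h
  | neg α _ =>
    cases α with
    | str a => exact fun hs => hH.neg h ((hH.str h1 hp).2 hs)
    | prop a => exact fun hs => hH.neg h ((hH.prop h1 hp).2 hs)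
    | _ => exact hψ.elim
  | and α β ih1 ih2 =>
    exact ⟨ih1 hψ.1 hC.and_left p h1 hp (hH.and h).1, ih2 hψ.2 hC.and_right p h1 hp (hH.and h).2⟩
  | or α β ih1 ih2 =>
    exact (hH.or h).imp (ih1 hψ.1 hC.or_left p h1 hp) (ih2 hψ.2 hC.or_right p h1 hp)
  | next t α ih =>
    obtain ⟨h2, h3, h4⟩ := hH.next h1 hp hC h
    exact ⟨h2, h3, ih hψ hC.next _ (by omega) h2 h4⟩
  | wnext t α ih =>
    exact fun h2 h3 => ih hψ hC.wnext _ (by omega) h2 (hH.wnext h1 h2 hC h h3)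
  | cnext t α ih =>
    obtain ⟨q, h2, h3, h4⟩ := hH.cnext h1 hp hC h
    exact ⟨q, h2.lt, h2, h3, ih hψ hC.cnext q (h1.trans h2.lt.le) h2.1 h4⟩
  | wcnext t α ih =>
    exact fun q _ h2 h3 => ih hψ hC.wcnext q (h1.trans h2.lt.le) h2.1 (hH.wcnext h1 hC h h2 h3)
  | hnext t α ih =>
    obtain ⟨q, h2, h3⟩ := hH.hnext h1 hp hC h
    exact ⟨q, h2, ih hψ hC.hnext q (h1.trans h2.lt.le) h2.le_last h3⟩
  | whnext t α ih =>
    exact fun q h2 => ih hψ hC.whnext q (h1.trans h2.lt.le) h2.le_last (hH.whnext h1 hC h h2)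
  | cuntil t α β ih1 ih2 =>
    exact sat_cuntil hL hH hC (ih1 hψ.1 hC.cuntil_left) (ih2 hψ.2 hC.cuntil_right) p h1 hp h
  | crelease t α β ih1 ih2 =>
    exact sat_crelease hH hC (ih1 hψ.1 hC.crelease_left) (ih2 hψ.2 hC.crelease_right) p h1 hp h
  | huntil t α β ih1 ih2 =>
    exact sat_huntil hL hH hC (ih1 hψ.1 hC.huntil_left) (ih2 hψ.2 hC.huntil_right) p h1 hp h
  | hrelease t α β ih1 ih2 =>
    exact sat_hrelease hH hC (ih1 hψ.1 hC.hrelease_left) (ih2 hψ.2 hC.hrelease_right) p h1 hp h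

end LocallyConsistent

end OPWord

namespace ParserRun

variable {Sg : Type u} {M : OPM Sg} {R : ParserRun M}

/-! ### The last pop with a given left context -/

/-- If `x + 1` is pushed and no shift follows a pop with left context `x`, then the last of the
pops with left context `x` is followed by a pop. -/
theorem exists_pop_pop {x : ℕ} (h1 : 1 ≤ x) (hx : x < R.len) (hp : ¬ R.Pop x)
    (hpush : R.Push (x + 1))
    (hns : ∀ z, z < R.len → R.Pop z → R.ctx z = x → ¬ R.Shift (z + 1)) :
    ∃ z, z + 1 < R.len ∧ R.Pop z ∧ R.Pop (z + 1) ∧ R.ctx z = x := by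
  classical
  -- the last node that has `x` on top of the stack
  set y := Nat.findGreatest (fun y => R.top y = x) R.len
  have hle : y ≤ R.len := Nat.findGreatest_le _
  have hty : R.top y = x :=
    Nat.findGreatest_spec (P := fun y => R.top y = x) hx (top_succ_of_not_pop hp)
  have hxy : x + 1 ≤ y := Nat.le_findGreatest hx (top_succ_of_not_pop hp)
  have hylen : y < R.len := by
    refine lt_of_le_of_ne hle fun h => ?_
    have := (inv (R := R) R.len_pos le_rfl).top_eq_zero R.stack_len
    rw [h] at hty
    omega
  have hnp : ¬ R.Push y := by
    intro h
    obtain ⟨z, hz1, hz2, hpz, hsz⟩ := h.exists_pop hylen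
    have htz : R.top (z + 1) = x := by
      rw [top_succ_of_pop hpz, ← (hpz.inv hz2.le).top_stack (hpz.stack_ne_zero hz2.le), hsz, hty]
    have := Nat.le_findGreatest (P := fun y => R.top y = x) hz2 htz
    omega
  obtain ⟨z, hz⟩ : ∃ z, y = z + 1 := ⟨y - 1, by omega⟩
  rw [hz] at hty hylen hnp
  have hpz : R.Pop z := by
    by_contra hpz
    rw [top_succ_of_not_pop hpz] at hty
    rw [hty] at hnp
    exact hnp hpush
  rw [top_succ_of_pop hpz] at hty
  have := push_or_shift_or_pop (R := R) (x := z + 1) (by omega) hylen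
  exact ⟨z, hylen, hpz, (this.resolve_left hnp).resolve_left (hns z (by omega) hpz hty), hty⟩

end ParserRun

theorem Sym.eq_of_structural {Sg : Type u} {AP : Type v} {s s' : Sym Sg AP} {a : Option Sg}
    (h : s.structural = some a) (h' : s'.structural = some a) : s = s' := by
  cases s <;> cases s' <;> cases a <;> simp_all [Sym.structural]

/-- The structural symbol denoted by a symbol-sorted value, `#` for the symbols that denote none. -/
def Sym.toOption {Sg : Type u} {AP : Type v} (s : Sym Sg AP) : Option Sg := s.structural.getD none

namespace Interp

variable {Sg : Type u} {AP : Type v} {φ : Formula Sg AP} {k K : ℕ} {I : Interp φ k} {M : OPM Sg}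

/-! ### The run given by a model of the encoding -/

/-- `K` is the first accepting node of a model of the unraveling. The rules do not forbid an earlier
accepting node: there `#` meets `#`, so that the run can continue with a shift. -/
structure FirstAccept (I : Interp φ k) (M : OPM Sg) (K : ℕ) : Prop where
  unraveling : I.Unraveling M
  one_le : 1 ≤ K
  le : K ≤ k
  accept : I.Accept K
  not_accept : ∀ x, 1 ≤ x → x < K → ¬ I.Accept x

theorem exists_firstAccept (hU : I.Unraveling M) (hk : 0 < k) (hA : I.Accept k) :
    ∃ K, I.FirstAccept M K := by
  classical
  have h : ∃ x, 1 ≤ x ∧ I.Accept x := ⟨k, hk, hA⟩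
  refine ⟨Nat.find h, hU, (Nat.find_spec h).1, Nat.find_min' h ⟨hk, hA⟩, (Nat.find_spec h).2, ?_⟩
  exact fun x h1 hx hax => Nat.find_min h hx ⟨h1, hax⟩

theorem Unraveling.structural_str (hU : I.Unraveling M) {x : ℕ} (hx : x ≤ k) :
    (I.str x).structural = some (I.str x).toOption := by
  have h := (hU.1.1 _ (I.str_mem x hx)).1 (hU.1.2 x hx).1
  unfold Sym.toOption
  rcases hs : (I.str x).structural with _ | a
  · exact absurd hs h
  · rfl

theorem Unraveling.structural_smb (hU : I.Unraveling M) {x : ℕ} (hx : x ≤ k) :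
    (I.smb x).structural = some (I.smb x).toOption := by
  have h := (hU.1.1 _ (I.smb_mem x hx)).1 (hU.1.2 x hx).2.1
  unfold Sym.toOption
  rcases hs : (I.smb x).structural with _ | a
  · exact absurd hs h
  · rfl

theorem Unraveling.push_iff (hU : I.Unraveling M) {x : ℕ} (hx : x ≤ k) :
    I.Push x ↔ M.prec (I.smb x).toOption (I.str x).toOption = some PR.lt := by
  have := (hU.2.1 _ (I.smb_mem x hx) _ (I.str_mem x hx)).1
  simpa [Interp.Push, OPM.symPrec, hU.structural_smb hx, hU.structural_str hx] using this

theorem Unraveling.shift_iff (hU : I.Unraveling M) {x : ℕ} (hx : x ≤ k) :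
    I.Shift x ↔ M.prec (I.smb x).toOption (I.str x).toOption = some PR.eq := by
  have := (hU.2.1 _ (I.smb_mem x hx) _ (I.str_mem x hx)).2.1
  simpa [Interp.Shift, OPM.symPrec, hU.structural_smb hx, hU.structural_str hx] using this

theorem Unraveling.pop_iff (hU : I.Unraveling M) {x : ℕ} (hx : x ≤ k) :
    I.Pop x ↔ M.prec (I.smb x).toOption (I.str x).toOption = some PR.gt := by
  have := (hU.2.1 _ (I.smb_mem x hx) _ (I.str_mem x hx)).2.2
  simpa [Interp.Pop, OPM.symPrec, hU.structural_smb hx, hU.structural_str hx] using this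

theorem Unraveling.lt_iff (hU : I.Unraveling M) {x y : ℕ} (hx : x ≤ k) (hy : y ≤ k) :
    I.lt (I.str x) (I.str y) ↔ M.prec (I.str x).toOption (I.str y).toOption = some PR.lt := by
  have := (hU.2.1 _ (I.str_mem x hx) _ (I.str_mem y hy)).1
  simpa [OPM.symPrec, hU.structural_str hy, hU.structural_str hx] using this

theorem Unraveling.eq_iff (hU : I.Unraveling M) {x y : ℕ} (hx : x ≤ k) (hy : y ≤ k) :
    I.eq (I.str x) (I.str y) ↔ M.prec (I.str x).toOption (I.str y).toOption = some PR.eq := by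
  have := (hU.2.1 _ (I.str_mem x hx) _ (I.str_mem y hy)).2.1
  simpa [OPM.symPrec, hU.structural_str hy, hU.structural_str hx] using this

theorem Unraveling.gt_iff (hU : I.Unraveling M) {x y : ℕ} (hx : x ≤ k) (hy : y ≤ k) :
    I.gt (I.str x) (I.str y) ↔ M.prec (I.str x).toOption (I.str y).toOption = some PR.gt := by
  have := (hU.2.1 _ (I.str_mem x hx) _ (I.str_mem y hy)).2.2
  simpa [OPM.symPrec, hU.structural_str hy, hU.structural_str hx] using this

/-- By `R2`, the only structural symbol in the label of a node is its lookahead. -/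
theorem Unraveling.eq_str (hU : I.Unraveling M) {x : ℕ} (h1 : 1 ≤ x) (hx : x ≤ k)
    {s : Sym Sg AP} (hs : s ∈ symSort φ) (hst : s.structural ≠ none) (h : I.lab s x) :
    s = I.str x :=
  (hU.2.2.2.1 x h1 hx).1 s hs _ (I.str_mem x hx) ((hU.1.1 s hs).2 hst) (hU.1.2 x hx).1 h
    (hU.1.2 x hx).2.2

theorem Unraveling.lab_hash_iff (hU : I.Unraveling M) {x : ℕ} (h1 : 1 ≤ x) (hx : x ≤ k) :
    I.lab .hash x ↔ (I.str x).toOption = none := by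
  constructor
  · intro h
    rw [← hU.eq_str (s := .hash) h1 hx trivial (by simp [Sym.structural]) h]
    rfl
  · intro h
    have h2 := hU.structural_str hx
    rw [h] at h2
    rw [Sym.eq_of_structural (s := .hash) rfl h2]
    exact (hU.1.2 x hx).2.2

theorem Unraveling.lab_str_iff (hU : I.Unraveling M) {x : ℕ} (h1 : 1 ≤ x) (hx : x ≤ k) {a : Sg} :
    I.lab (.str a) x ↔ (I.str x).toOption = some a := by
  constructor
  · intro h
    rw [← hU.eq_str (s := .str a) h1 hx trivial (by simp [Sym.structural]) h]
    rfl
  · intro h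
    have h2 := hU.structural_str hx
    rw [h] at h2
    rw [Sym.eq_of_structural (s := .str a) rfl h2]
    exact (hU.1.2 x hx).2.2

/-- The parser run encoded by a model of the unraveling, up to its first accepting node. -/
def FirstAccept.run (hA : I.FirstAccept M K) : ParserRun M :=
  have hU := hA.unraveling
  have hle := hA.le
  have hstep := hU.2.2.2.2
  have hinit := hU.2.2.1
  { len := K
    len_pos := hA.one_le
    look := fun x => (I.str x).toOption
    smb := fun x => (I.smb x).toOption
    stack := I.stack
    ctx := I.ctx
    look_zero := by rw [hinit.2.2.1]; rfl
    smb_zero := by rw [hinit.2.2.2.1]; rfl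
    smb_one := by rw [hinit.2.2.2.2.1]; rfl
    stack_one := hinit.2.2.2.2.2.1
    ctx_one := hinit.2.2.2.2.2.2.1
    look_len := (hU.lab_hash_iff hA.one_le hA.le).1 hA.accept.1
    stack_len := hA.accept.2
    not_accept := fun x h1 hx h =>
      hA.not_accept x h1 hx ⟨(hU.lab_hash_iff h1 (by omega)).2 h.1, h.2⟩
    prec_ne_none := fun x h1 hx h => by
      rcases (hstep x h1 (by omega)).1 with h2 | h2 | h2
      · rw [hU.push_iff (by omega), h] at h2; cases h2
      · rw [hU.shift_iff (by omega), h] at h2; cases h2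
      · rw [hU.pop_iff (by omega), h] at h2; cases h2
    smb_succ := fun x h1 hx h => by
      rw [ne_eq, ← hU.pop_iff (by omega)] at h
      obtain ⟨h2, h3, h4, -⟩ := hstep x h1 (by omega)
      rcases h2 with h2 | h2 | h2
      · rw [(h3 h2).2.1]
      · rw [(h4 h2).2.1]
      · exact absurd h2 h
    stack_push := fun x h1 hx h =>
      ((hstep x h1 (by omega)).2.1 ((hU.push_iff (by omega)).2 h)).2.2.1
    ctx_push_zero := fun x h1 hx h =>
      ((hstep x h1 (by omega)).2.1 ((hU.push_iff (by omega)).2 h)).2.2.2.1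
    ctx_push := fun x h1 hx h h0 hp => by
      refine ((hstep x h1 (by omega)).2.1 ((hU.push_iff (by omega)).2 h)).2.2.2.2.1 ⟨h0, ?_⟩
      rw [ne_eq, ← hU.pop_iff (by omega)] at hp
      rcases Nat.eq_zero_or_pos (x - 1) with hx0 | hx0
      · right
        rw [hx0, hU.shift_iff (by omega), hinit.2.2.1, hinit.2.2.2.1]
        rfl
      · have := (hstep (x - 1) hx0 (by omega)).1
        tauto
    ctx_push_pop := fun x h1 hx h h0 hp =>
      ((hstep x h1 (by omega)).2.1 ((hU.push_iff (by omega)).2 h)).2.2.2.2.2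
        ⟨h0, (hU.pop_iff (by omega)).2 hp⟩
    stack_shift := fun x h1 hx h =>
      ((hstep x h1 (by omega)).2.2.1 ((hU.shift_iff (by omega)).2 h)).2.2.1
    ctx_shift := fun x h1 hx h =>
      ((hstep x h1 (by omega)).2.2.1 ((hU.shift_iff (by omega)).2 h)).2.2.2
    look_pop := fun x h1 hx h => by
      have h2 := ((hstep x h1 (by omega)).2.2.2 ((hU.pop_iff (by omega)).2 h)).1
      have h3 := (h2 _ (I.str_mem x (by omega))).1 (hU.1.2 x (by omega)).2.2
      rw [hU.eq_str (x := x + 1) (by omega) (by omega) (I.str_mem x (by omega))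
        (by rw [hU.structural_str (by omega)]; simp) h3]
    smb_pop := fun x h1 hx h => by
      rw [((hstep x h1 (by omega)).2.2.2 ((hU.pop_iff (by omega)).2 h)).2.1]
    stack_pop := fun x h1 hx h =>
      ((hstep x h1 (by omega)).2.2.2 ((hU.pop_iff (by omega)).2 h)).2.2.1
    ctx_pop := fun x h1 hx h =>
      ((hstep x h1 (by omega)).2.2.2 ((hU.pop_iff (by omega)).2 h)).2.2.2 }

/-- Nodes with the same label satisfy the same members of the closure. -/
theorem xnf_congr {x y : ℕ} (h : ∀ s ∈ symSort φ, I.lab s x ↔ I.lab s y) {ψ : Formula Sg AP}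
    (hC : Closure φ ψ) : I.Xnf ψ x ↔ I.Xnf ψ y := by
  induction ψ with
  | str a => exact h (.str a) trivial
  | prop a => exact h (.prop a) trivial
  | neg α ih => exact not_congr (ih hC.neg)
  | and α β ih1 ih2 => exact and_congr (ih1 hC.and_left) (ih2 hC.and_right)
  | or α β ih1 ih2 => exact or_congr (ih1 hC.or_left) (ih2 hC.or_right)
  | next t α _ => exact h (.ground _) ⟨hC, Or.inl trivial⟩
  | wnext t α _ => exact h (.ground _) ⟨hC, Or.inr trivial⟩
  | cnext t α _ => exact h (.ground _) ⟨hC, Or.inl trivial⟩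
  | wcnext t α _ => exact h (.ground _) ⟨hC, Or.inr trivial⟩
  | hnext t α _ => exact h (.ground _) ⟨hC, Or.inl trivial⟩
  | whnext t α _ => exact h (.ground _) ⟨hC, Or.inr trivial⟩
  | cuntil t α β ih1 ih2 =>
    exact or_congr (ih2 hC.cuntil_right) (and_congr (ih1 hC.cuntil_left)
      (or_congr (h (.ground _) ⟨hC.cuntil_next, Or.inl trivial⟩)
        (h (.ground _) ⟨hC.cuntil_cnext, Or.inl trivial⟩)))
  | crelease t α β ih1 ih2 =>
    exact and_congr (ih2 hC.crelease_right) (or_congr (ih1 hC.crelease_left)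
      (and_congr (h (.ground _) ⟨hC.crelease_wnext, Or.inr trivial⟩)
        (h (.ground _) ⟨hC.crelease_wcnext, Or.inr trivial⟩)))
  | huntil t α β ih1 ih2 =>
    exact or_congr (and_congr (ih2 hC.huntil_right) (h (.zeta t) trivial))
      (and_congr (ih1 hC.huntil_left) (h (.ground _) ⟨hC.huntil_hnext, Or.inl trivial⟩))
  | hrelease t α β ih1 ih2 =>
    exact and_congr (imp_congr (h (.zeta t) trivial) (ih2 hC.hrelease_right))
      (or_congr (ih1 hC.hrelease_left) (h (.ground _) ⟨hC.hrelease_whnext, Or.inr trivial⟩))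

namespace FirstAccept

open ParserRun

theorem push_iff (hA : I.FirstAccept M K) {x : ℕ} (hx : x ≤ K) : I.Push x ↔ hA.run.Push x :=
  hA.unraveling.push_iff (hx.trans hA.le)

theorem shift_iff (hA : I.FirstAccept M K) {x : ℕ} (hx : x ≤ K) : I.Shift x ↔ hA.run.Shift x :=
  hA.unraveling.shift_iff (hx.trans hA.le)

theorem pop_iff (hA : I.FirstAccept M K) {x : ℕ} (hx : x ≤ K) : I.Pop x ↔ hA.run.Pop x :=
  hA.unraveling.pop_iff (hx.trans hA.le)

end FirstAccept

end Interp

namespace Interp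

variable {Sg : Type u} {AP : Type v} {φ : Formula Sg AP} {k K : ℕ} {I : Interp φ k} {M : OPM Sg}

namespace FirstAccept

/-! ### The labels of a model -/

open ParserRun

/-- The word read by the run of a model, labelled as in the model. -/
noncomputable def word (hA : I.FirstAccept M K) : OPWord M AP :=
  hA.run.toWord fun p => {a | I.lab (.prop a) (hA.run.node p)}

theorem rules (hA : I.FirstAccept M K) {x : ℕ} (h1 : 1 ≤ x) (hx : x ≤ K) :
    I.R2 x ∧ I.R3 x ∧ I.R4 x ∧ I.R5 x ∧ I.R6 x ∧ I.R7 x ∧ I.R8 x ∧ I.R9 x ∧ I.R10 x ∧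
      I.R11 x ∧ I.R12 x ∧ I.R13 x :=
  hA.unraveling.2.2.2.1 x h1 (hx.trans hA.le)

theorem lab_succ_of_pop (hA : I.FirstAccept M K) {x : ℕ} (h : hA.run.Pop x) (hx : x < K)
    {s : Sym Sg AP} (hs : s ∈ symSort φ) : I.lab s x ↔ I.lab s (x + 1) :=
  ((hA.unraveling.2.2.2.2 x h.pos (hx.trans_le hA.le)).2.2.2 ((hA.pop_iff hx.le).2 h)).1 s hs

/-- Labels do not change during a sequence of pops. -/
theorem lab_congr (hA : I.FirstAccept M K) {x y : ℕ} (hle : x ≤ y) (hy : y ≤ K)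
    (h : hA.run.pos x = hA.run.pos y) {s : Sym Sg AP} (hs : s ∈ symSort φ) :
    I.lab s x ↔ I.lab s y := by
  induction y, hle using Nat.le_induction with
  | base => rfl
  | succ y hle ih =>
    have hp : hA.run.Pop y := pop_of_pos_eq (y := y + 1) (by
      have h1 := pos_mono (R := hA.run) hle
      have h2 := pos_mono (R := hA.run) (Nat.le_succ y)
      simp only [Nat.succ_eq_add_one] at h2
      omega) (by omega)
    rw [pos_succ_of_pop hp] at h
    rw [ih (by omega) h, hA.lab_succ_of_pop hp hy hs]

theorem xnf_node (hA : I.FirstAccept M K) {x : ℕ} (hx : x ≤ K) {ψ : Formula Sg AP}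
    (hC : Closure φ ψ) : I.Xnf ψ (hA.run.node (hA.run.pos x)) ↔ I.Xnf ψ x :=
  (xnf_congr (fun _ hs => hA.lab_congr (le_node (R := hA.run) hx) (node_le _)
    (pos_node (pos_mono (R := hA.run) hx)).symm hs) hC).symm

theorem lt_iff (hA : I.FirstAccept M K) {x y : ℕ} (hx : x ≤ K) (hy : y ≤ K) :
    I.lt (I.str x) (I.str y) ↔ hA.word.Rel PR.lt (hA.run.pos x) (hA.run.pos y) := by
  change _ ↔ M.prec (hA.run.sym _) (hA.run.sym _) = _
  rw [sym_pos (R := hA.run) hx, sym_pos (R := hA.run) hy]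
  exact hA.unraveling.lt_iff (hx.trans hA.le) (hy.trans hA.le)

theorem eq_iff (hA : I.FirstAccept M K) {x y : ℕ} (hx : x ≤ K) (hy : y ≤ K) :
    I.eq (I.str x) (I.str y) ↔ hA.word.Rel PR.eq (hA.run.pos x) (hA.run.pos y) := by
  change _ ↔ M.prec (hA.run.sym _) (hA.run.sym _) = _
  rw [sym_pos (R := hA.run) hx, sym_pos (R := hA.run) hy]
  exact hA.unraveling.eq_iff (hx.trans hA.le) (hy.trans hA.le)

theorem gt_iff (hA : I.FirstAccept M K) {x y : ℕ} (hx : x ≤ K) (hy : y ≤ K) :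
    I.gt (I.str x) (I.str y) ↔ hA.word.Rel PR.gt (hA.run.pos x) (hA.run.pos y) := by
  change _ ↔ M.prec (hA.run.sym _) (hA.run.sym _) = _
  rw [sym_pos (R := hA.run) hx, sym_pos (R := hA.run) hy]
  exact hA.unraveling.gt_iff (hx.trans hA.le) (hy.trans hA.le)

theorem dirPr_iff (hA : I.FirstAccept M K) {x y : ℕ} (hx : x ≤ K) (hy : y ≤ K) {t : Dir} :
    I.DirPr t x y ↔ hA.word.DirRel t (hA.run.pos x) (hA.run.pos y) := by
  cases t with
  | d => exact or_congr (hA.lt_iff hx hy) (hA.eq_iff hx hy)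
  | u => exact or_congr (hA.gt_iff hx hy) (hA.eq_iff hx hy)

/-- By `R3`, a position labelled by a strong next formula is not the last one. -/
theorem lt_last_of_strongNext (hA : I.FirstAccept M K) {p : ℕ} (hp : p ≤ hA.word.last)
    {ψ : Formula Sg AP} (hC : Closure φ ψ) (hs : ψ.IsStrongNext)
    (h : I.lab (.ground ψ) (hA.run.node p)) : p < hA.word.last := by
  refine lt_of_le_of_ne hp ?_
  rintro rfl
  change I.lab (.ground ψ) (hA.run.node (hA.run.pos hA.run.len)) at h
  rw [node_last] at h
  exact ((hA.rules hA.one_le le_rfl).2.1 hA.accept.1).1 ψ hC hs h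

theorem lt_last_of_zeta (hA : I.FirstAccept M K) {p : ℕ} (hp : p ≤ hA.word.last)
    {t : Dir} (h : I.lab (.zeta t) (hA.run.node p)) : p < hA.word.last := by
  refine lt_of_le_of_ne hp ?_
  rintro rfl
  change I.lab (.zeta t) (hA.run.node (hA.run.pos hA.run.len)) at h
  rw [node_last] at h
  exact ((hA.rules hA.one_le le_rfl).2.1 hA.accept.1).2.2 t h

/-- An inner position is read by a push or a shift node. -/
theorem exists_node (hA : I.FirstAccept M K) {p : ℕ} (h1 : 1 ≤ p) (hp : p < hA.word.last) :
    ∃ x, hA.run.node p = x ∧ hA.run.pos x = p ∧ 1 ≤ x ∧ x < K ∧ ¬ hA.run.Pop x ∧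
      (hA.run.Push x ∨ hA.run.Shift x) := by
  have hp' : p < hA.run.pos hA.run.len := hp
  have hx := node_lt_len hp'
  have hx1 := one_le_node h1 hp'.le
  have hn := not_pop_node hp'.le
  have := push_or_shift_or_pop hx1 hx
  exact ⟨_, rfl, pos_node hp'.le, hx1, hx, hn, by tauto⟩

theorem next (hA : I.FirstAccept M K) {p : ℕ} {t : Dir} {α : Formula Sg AP} (h1 : 1 ≤ p)
    (hp : p ≤ hA.word.last) (hC : Closure φ (.next t α))
    (h : I.Xnf (.next t α) (hA.run.node p)) :
    p < hA.word.last ∧ hA.word.DirRel t p (p + 1) ∧ I.Xnf α (hA.run.node (p + 1)) := by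
  have hlt := hA.lt_last_of_strongNext hp hC trivial h
  obtain ⟨x, hnx, hpos, hx1, hx, hnp, hps⟩ := hA.exists_node h1 hlt
  rw [hnx] at h
  have hpos1 := pos_succ_of_not_pop hnp
  rw [hpos] at hpos1
  rw [← hA.push_iff hx.le, ← hA.shift_iff hx.le] at hps
  have hstep := hA.unraveling.2.2.2.2 x hx1 (hx.trans_le hA.le)
  have hnext : I.StepNext x := hps.elim (fun h => (hstep.2.1 h).1) fun h => (hstep.2.2.1 h).1
  refine ⟨hlt, ?_, ?_⟩
  · have hrel := (OPWord.link_succ hlt).exists_rel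
    obtain ⟨hd, hu⟩ := (hA.rules (x := x + 1) (by omega) hx).2.2.1 hps
    rw [Nat.add_sub_cancel] at hd hu
    rw [hA.gt_iff hx.le hx, hpos, hpos1] at hd
    rw [hA.lt_iff hx.le hx, hpos, hpos1] at hu
    cases t with
    | d => have := fun h' => hd α hC ⟨h, h'⟩; unfold OPWord.DirRel Dir.pr; tauto
    | u => have := fun h' => hu α hC ⟨h, h'⟩; unfold OPWord.DirRel Dir.pr; tauto
  · rw [← hpos1, hA.xnf_node hx hC.next]
    exact hnext t α hC h

theorem wnext (hA : I.FirstAccept M K) {p : ℕ} {t : Dir} {α : Formula Sg AP} (h1 : 1 ≤ p)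
    (hlt : p < hA.word.last) (hC : Closure φ (.wnext t α))
    (h : I.Xnf (.wnext t α) (hA.run.node p)) (hr : hA.word.DirRel t p (p + 1)) :
    I.Xnf α (hA.run.node (p + 1)) := by
  obtain ⟨x, hnx, hpos, hx1, hx, hnp, hps⟩ := hA.exists_node h1 hlt
  rw [hnx] at h
  have hpos1 := pos_succ_of_not_pop hnp
  rw [hpos] at hpos1
  rw [← hA.push_iff hx.le, ← hA.shift_iff hx.le] at hps
  obtain ⟨hd, hu⟩ := (hA.rules (x := x + 1) (by omega) hx).2.2.2.1 hps
  rw [Nat.add_sub_cancel] at hd hu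
  rw [hA.gt_iff hx.le hx, hpos, hpos1] at hd
  rw [hA.lt_iff hx.le hx, hpos, hpos1] at hu
  rw [← hpos1, hA.xnf_node hx hC.wnext]
  cases t with
  | d => exact hd α hC ⟨h, hr.not_gt⟩
  | u => exact hu α hC ⟨h, hr.not_lt⟩

theorem cnext (hA : I.FirstAccept M K) {p : ℕ} {t : Dir} {α : Formula Sg AP} (h1 : 1 ≤ p)
    (hp : p ≤ hA.word.last) (hC : Closure φ (.cnext t α))
    (h : I.Xnf (.cnext t α) (hA.run.node p)) :
    ∃ q, hA.word.Chain p q ∧ hA.word.DirRel t p q ∧ I.Xnf α (hA.run.node q) := by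
  have hlt := hA.lt_last_of_strongNext hp hC trivial h
  obtain ⟨x, hnx, hpos, hx1, hx, hnp, hps⟩ := hA.exists_node h1 hlt
  rw [hnx] at h
  -- the node that pops the block of `x`
  obtain ⟨z, hxz, hz, hpz, hsz⟩ : ∃ z, x < z ∧ z < K ∧ hA.run.Pop z ∧
      (x = I.stack z ∨ (I.Shift x ∧ I.stack x = I.stack z)) := by
    rcases hps with h2 | h2
    · obtain ⟨z, hz1, hz2, hz3, hz4⟩ := h2.exists_pop hx
      exact ⟨z, hz1, hz2, hz3, Or.inl hz4.symm⟩
    · obtain ⟨z, hz1, hz2, hz3, hz4⟩ := h2.exists_pop hx1 hx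
      exact ⟨z, hz1, hz2, hz3, Or.inr ⟨(hA.shift_iff hx.le).2 h2, hz4.symm⟩⟩
  obtain ⟨y, hy1, hy2, hpy, hcy, hdir, hα⟩ :=
    (hA.rules (by omega) hz.le).2.2.2.2.1 ((hA.pop_iff hz.le).2 hpz) x hxz hsz t α hC h
  have hyK : y ≤ K := hy2.trans hz.le
  rw [hA.pop_iff hyK] at hpy
  have hch : hA.word.Chain _ _ := chain_pos hpy hyK
  have hc : hA.run.ctx y = x := hcy
  rw [hc, hpos] at hch
  rw [hA.dirPr_iff hx.le hyK, hpos] at hdir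
  exact ⟨_, hch, hdir, (hA.xnf_node hyK hC.cnext).2 hα⟩

theorem wcnext (hA : I.FirstAccept M K) {p q : ℕ} {t : Dir} {α : Formula Sg AP}
    (hC : Closure φ (.wcnext t α)) (h : I.Xnf (.wcnext t α) (hA.run.node p))
    (hch : hA.word.Chain p q) (hr : hA.word.DirRel t p q) : I.Xnf α (hA.run.node q) := by
  obtain ⟨z, hz, hpz, rfl, hcz⟩ := exists_pop_of_chain hch
  have hzK : z ≤ K := hz.le
  have hc : I.ctx z = hA.run.node p := hcz
  have hpn : hA.run.pos (hA.run.node p) = p := pos_node (hch.lt.le.trans hch.1)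
  rw [hA.xnf_node hzK hC.wcnext]
  refine (hA.rules hpz.pos hzK).2.2.2.2.2.1 ((hA.pop_iff hzK).2 hpz) t α hC ⟨hc ▸ h, ?_⟩
  rwa [hc, hA.dirPr_iff (node_le _) hzK, hpn]

theorem hnext_u (hA : I.FirstAccept M K) {p : ℕ} {α : Formula Sg AP} (h1 : 1 ≤ p)
    (hp : p ≤ hA.word.last) (hC : Closure φ (.hnext .u α))
    (h : I.Xnf (.hnext .u α) (hA.run.node p)) :
    ∃ q, hA.word.HierNext .u p q ∧ I.Xnf α (hA.run.node q) := by
  have hlt := hA.lt_last_of_strongNext hp hC trivial h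
  obtain ⟨x, hnx, hpos, hx1, hx, hnp, hps⟩ := hA.exists_node h1 hlt
  rw [hnx] at h
  have hu := (hA.rules (x := x + 1) (by omega) hx).2.2.2.2.2.2.1.1
  rw [Nat.add_sub_cancel] at hu
  have hu' := hu ⟨_, ⟨α, hC, rfl⟩, h⟩
  rw [hA.pop_iff hx.le, hA.push_iff hx.le, hA.pop_iff (by omega)] at hu'
  obtain ⟨hpush, hpop⟩ := hu'.resolve_left hnp
  obtain ⟨z, hxz, hz, hpz, hsz⟩ := hpush.exists_pop hx
  have hzK : z < K := hz
  have h8 := (hA.rules (x := z + 1) (by omega) hz).2.2.2.2.2.2.1.2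
  rw [Nat.add_sub_cancel] at h8
  have hs : I.stack z = x := hsz
  obtain ⟨hα, hpz1⟩ := h8 ((hA.pop_iff hzK.le).2 hpz) α hC (by rwa [hs])
  rw [hA.push_iff hzK] at hpz1
  have hn : hA.word.HierNext .u _ _ := hierNext_u_of_pop hz.le hpz hpz1 (by rwa [hsz])
  rw [hsz, hpos] at hn
  exact ⟨_, hn, (hA.xnf_node hzK.le hC.hnext).2 hα⟩

theorem whnext_u (hA : I.FirstAccept M K) {p q : ℕ} {α : Formula Sg AP}
    (hC : Closure φ (.whnext .u α)) (h : I.Xnf (.whnext .u α) (hA.run.node p))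
    (hn : hA.word.HierNext .u p q) : I.Xnf α (hA.run.node q) := by
  obtain ⟨z, hz, hpz, hpz1, hps, hpush, hsz, rfl⟩ := exists_pop_of_hierNext_u hn
  have hzK : z < K := hz
  have hs : I.stack z = hA.run.node p := hsz
  have hlt := (hpz.inv hz.le).stack_lt
  have h9 := (hA.rules (x := z + 1) (by omega) hz).2.2.2.2.2.2.2.1
  unfold R9 at h9
  rw [Nat.add_sub_cancel, hA.pop_iff hzK.le, hA.push_iff hzK] at h9
  rw [hA.xnf_node hzK.le hC.whnext]
  refine h9 ⟨hpz, hpz1, ?_, ?_⟩ α hC (by rwa [hs])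
  · exact (hA.pop_iff (show hA.run.stack z - 1 ≤ K by omega)).2 hps
  · exact (hA.push_iff (show hA.run.stack z ≤ K by omega)).2 hpush

/-- A position that carries a symbol subject to `HdCond` is the left context of some pop that is
followed by another pop. -/
theorem exists_pop_pop_of_hdCond (hA : I.FirstAccept M K) {p : ℕ} {F : Set (Sym Sg AP)}
    (h1 : 1 ≤ p) (hp : p < hA.word.last) (hF : ∀ x, x < K → I.HdCond F x)
    (h : I.AnyOf F (hA.run.node p)) :
    ∃ z, z + 1 < K ∧ hA.run.Pop z ∧ hA.run.Pop (z + 1) ∧ hA.run.ctx z = hA.run.node p := by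
  obtain ⟨x, hnx, hpos, hx1, hx, hnp, hps⟩ := hA.exists_node h1 hp
  rw [hnx] at h ⊢
  refine exists_pop_pop hx1 hx hnp ?_ ?_
  · rw [← hA.push_iff hx]
    exact (hF x hx).1 ⟨by rwa [hA.pop_iff hx.le], h⟩
  · intro z hz hpz hcz
    have hzK : z < K := hz
    rw [← hA.shift_iff hzK]
    have hc : I.ctx z = x := hcz
    exact (hF z hzK).2 ⟨by rwa [hA.pop_iff hzK.le], by rwa [hc]⟩

theorem hnext_d (hA : I.FirstAccept M K) {p : ℕ} {α : Formula Sg AP} (h1 : 1 ≤ p)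
    (hp : p ≤ hA.word.last) (hC : Closure φ (.hnext .d α))
    (h : I.Xnf (.hnext .d α) (hA.run.node p)) :
    ∃ q, hA.word.HierNext .d p q ∧ I.Xnf α (hA.run.node q) := by
  have hlt := hA.lt_last_of_strongNext hp hC trivial h
  obtain ⟨z, hz, hpz, hpz1, hcz⟩ := hA.exists_pop_pop_of_hdCond h1 hlt
    (F := {s | ∃ α, Closure φ (.hnext .d α) ∧ s = .ground (.hnext .d α)})
    (fun x hx => by
      have := (hA.rules (x := x + 1) (by omega) hx).2.2.2.2.2.2.2.2.1.1
      rwa [Nat.add_sub_cancel] at this)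
    ⟨_, ⟨α, hC, rfl⟩, h⟩
  have h10 := (hA.rules (x := z + 1) (by omega) hz.le).2.2.2.2.2.2.2.2.1.2
  rw [Nat.add_sub_cancel, hA.pop_iff (by omega), hA.pop_iff hz.le] at h10
  have hc : I.ctx z = hA.run.node p := hcz
  obtain ⟨hα, hpop⟩ := h10 ⟨hpz, hpz1⟩ α hC (by rwa [hc])
  rw [hA.pop_iff (by omega)] at hpop
  obtain ⟨y, rfl⟩ : ∃ y, z = y + 1 := ⟨z - 1, by have := hpz.pos; omega⟩
  change hA.run.Pop y at hpop
  have hn : hA.word.HierNext .d _ _ := hierNext_d_of_pop hz.le hpop hpz hpz1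
  rw [hcz, pos_node (show p ≤ hA.run.pos hA.run.len from hp)] at hn
  refine ⟨_, hn, ?_⟩
  rw [node_pos_ctx hpop (show y ≤ K by omega)]
  exact hα

theorem whnext_d (hA : I.FirstAccept M K) {p q : ℕ} {α : Formula Sg AP}
    (hC : Closure φ (.whnext .d α)) (h : I.Xnf (.whnext .d α) (hA.run.node p))
    (hn : hA.word.HierNext .d p q) : I.Xnf α (hA.run.node q) := by
  obtain ⟨y, hy, hpy, hpy1, hpy2, hc1, hc⟩ := exists_pop_of_hierNext_d hn
  have hyK : y + 2 < K := hy
  have h11 := (hA.rules (x := y + 2) (by omega) hyK.le).2.2.2.2.2.2.2.2.2.1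
  change I.Pop y ∧ I.Pop (y + 1) ∧ I.Pop (y + 2) → ∀ α, Closure φ (.whnext .d α) →
    I.lab (.ground (.whnext .d α)) (I.ctx (y + 1)) → I.Xnf α (I.ctx y) at h11
  have hc1' : I.ctx (y + 1) = hA.run.node p := hc1
  have hc' : I.ctx y = hA.run.node q := hc
  rw [hA.pop_iff (by omega), hA.pop_iff (by omega), hA.pop_iff (by omega), hc1', hc'] at h11
  exact h11 ⟨hpy, hpy1, hpy2⟩ α hC h

/-- `ζ_t` marks exactly the hierarchical positions. -/
theorem zeta_iff (hA : I.FirstAccept M K) {p : ℕ} {t : Dir} (h1 : 1 ≤ p)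
    (hp : p ≤ hA.word.last) :
    I.lab (.zeta t) (hA.run.node p) ↔ hA.word.IsHier t p := by
  have hpp : hA.run.pos (hA.run.node p) = p := pos_node hp
  cases t with
  | d =>
    constructor
    · intro h
      obtain ⟨z, hz, hpz, hpz1, hcz⟩ := hA.exists_pop_pop_of_hdCond h1 (hA.lt_last_of_zeta hp h)
        (F := {.zeta .d})
        (fun x hx => by
          have := (hA.rules (x := x + 1) (by omega) hx).2.2.2.2.2.2.2.2.2.2.1.1.1
          rwa [Nat.add_sub_cancel] at this)
        ⟨_, rfl, h⟩
      have hzK : z ≤ hA.run.len := (Nat.le_succ z).trans hz.le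
      have hch : hA.word.Chain _ _ := chain_pos hpz hzK
      have hr : hA.word.Rel PR.gt _ _ := (rel_pos_iff hpz hzK).2 hpz1
      rw [hcz, hpp] at hch hr
      exact ⟨_, hch, hr⟩
    · rintro ⟨h, hch, hr⟩
      obtain ⟨z, hz, hpz, hpz1, -, hcz⟩ := pop_of_chain_of_rel_gt hch hr
      have hzK : z + 1 < K := hz
      have h12 := (hA.rules (x := z + 1) (by omega) hzK.le).2.2.2.2.2.2.2.2.2.2.1.1.2
      rw [Nat.add_sub_cancel, hA.pop_iff (by omega), hA.pop_iff hzK.le] at h12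
      have hc : I.ctx z = hA.run.node p := hcz
      rw [← hc]
      exact h12 ⟨hpz, hpz1⟩
  | u =>
    constructor
    · intro h
      obtain ⟨x, hnx, hpos, hx1, hx, hnp, hps⟩ := hA.exists_node h1 (hA.lt_last_of_zeta hp h)
      rw [hnx] at h
      have h12 := (hA.rules hx1 hx.le).2.2.2.2.2.2.2.2.2.2.1.2.1 ⟨_, rfl, h⟩
      rw [hA.pop_iff hx.le, hA.push_iff hx.le, hA.pop_iff (by omega)] at h12
      obtain ⟨hpush, hpop⟩ := h12.resolve_left hnp
      obtain ⟨z, rfl⟩ : ∃ z, x = z + 1 := ⟨x - 1, by omega⟩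
      rw [Nat.add_sub_cancel] at hpop
      have hzK : z ≤ hA.run.len := (Nat.le_succ z).trans hx.le
      have hch : hA.word.Chain _ _ := chain_pos hpop hzK
      have hr : hA.word.Rel PR.lt _ _ := (rel_pos_iff hpop hzK).2 hpush
      rw [← pos_succ_of_pop hpop, hpos] at hch hr
      exact ⟨_, hch, hr⟩
    · rintro ⟨h, hch, hr⟩
      obtain ⟨hpush, hpop, -⟩ := push_of_chain_of_rel_lt hch hr
      have hx : hA.run.node p ≤ K := node_le p
      have h12 := (hA.rules (one_le_node h1 hp) hx).2.2.2.2.2.2.2.2.2.2.1.2.2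
      rw [hA.pop_iff (by omega), hA.push_iff hx] at h12
      exact h12 ⟨hpop, hpush⟩

theorem locallyConsistent (hA : I.FirstAccept M K) :
    hA.word.LocallyConsistent φ fun p ψ => I.Xnf ψ (hA.run.node p) where
  str h1 hp :=
    hA.unraveling.lab_str_iff (one_le_node (R := hA.run) h1 hp) ((node_le _).trans hA.le)
  prop _ _ := Iff.rfl
  neg h := h
  and h := h
  or h := h
  next h1 hp hC h := hA.next h1 hp hC h
  wnext h1 hp hC h hr := hA.wnext h1 hp hC h hr
  cnext h1 hp hC h := hA.cnext h1 hp hC h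
  wcnext _ hC h hch hr := hA.wcnext hC h hch hr
  hnext {p t α} h1 hp hC h := by
    cases t with
    | d => exact hA.hnext_d h1 hp hC h
    | u => exact hA.hnext_u h1 hp hC h
  whnext {p q t α} h1 hC h hn := by
    cases t with
    | d => exact hA.whnext_d hC h hn
    | u => exact hA.whnext_u hC h hn
  cuntil h := h
  crelease h := h
  huntil h1 hp h := h.imp_left fun h => ⟨h.1, (hA.zeta_iff h1 hp).1 h.2⟩
  hrelease h1 hp h := ⟨fun hz => h.1 ((hA.zeta_iff h1 hp).2 hz), h.2⟩

end FirstAccept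

end Interp

end POTL

theorem mainTheorem2 {Sg : Type*} {AP : Type*} [Finite Sg] [Finite AP]
    (M : POTL.OPM Sg) (φ : POTL.Formula Sg AP) (k : ℕ) (hk : 0 < k)
    (h : POTL.EncodingSatisfiable M φ k) : POTL.Satisfiable M φ := by
  obtain ⟨I, hU, hacc⟩ := h
  obtain ⟨K, hA⟩ := POTL.Interp.exists_firstAccept hU hk hacc
  have hlast : 1 ≤ hA.word.last := hA.word.last_pos
  have hL : hA.word.ChainLaws := POTL.ParserRun.chainLaws
  have hinit : I.Xnf (POTL.nnf φ) (hA.run.node 1) := by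
    have := (hA.xnf_node hA.one_le .self).2 hU.2.2.1.2.2.2.2.2.2.2
    rwa [POTL.ParserRun.pos_one] at this
  have hsat := hA.locallyConsistent.sat hL (POTL.isNNF_nnfAux φ true) .self 1 le_rfl hlast hinit
  exact ⟨hA.word, ((hL.sat_nnfAux φ).1 1).1 hsat⟩
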